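/- Let $X$, $Y$, $Z$ be random elements of arbitrary measurable spaces defined on one probability space, and put $$D(X:Y)=\sup\{\operatorname{var}E\{\varphi(X)\mid Y\}\;:\;\varphi\text{ real measurable},\ \|\varphi\|^2=E\,\varphi(X)^2=1\}.$$ Write $\rho(U,V)=\operatorname{cov}(U,V)/\sqrt{\operatorname{var}U\,\operatorname{var}V}$ for the Pearson correlation of square-integrable real random variables with positive variances, and let $R(X,Y)=\sup\rho(\varphi(X),\phi(Y))$ be the maximal correlation, where the supremum is taken over all real measurable $\varphi,\phi$ with $0<\operatorname{var}\varphi(X)<\infty$ and $0<\operatorname{var}\phi(Y)<\infty$ (the supremum of the empty set being $0$). A real random variable $Z$ is called self-decomposable if for every $0<c<1$ there is a random variable $Z_c$, independent of $Z$ (possibly on an enlarged probability space), such that $Z$ and $cZ+Z_c$ have the same distribution. Then: (i) $0\le D(X:Y)\le 1$. (ii) $D(X:Y)=0$ if and only if $X$ and $Y$ are independent. (iii) If $X=h(Y)$ almost surely for a measurable $h$, and $X$ is nondegenerate (that is, $0<P(X\in A)<1$ for some measurable set $A$), then $D(X:Y)=1$. The converse fails: there are real random variables $X,Y$ with $D(X:Y)=1$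 such that $X$ is not almost surely equal to a measurable function of $Y$. (iv) $D(X:(Y,Z))\ge D(X:Y)$ for every random element $Z$. (v) If $Z$ is independent of the pair $(X,Y)$, then $D(X:(Y,Z))=D(X:Y)$. (vi) If $(X,Y)$ is a bivariate Gaussian vector with positive variances and correlation $\rho$, then $D(X:Y)=\rho^2$. (vii) For any real square-integrable $X,Y$ with positive variances and correlation $\rho$, $D(X:Y)\ge\rho^2$. (viii) Let $(X,Y)$ be an $(m+n)$-dimensional Gaussian vector, $m\ge1$, with covariance matrix $\begin{pmatrix}V_{11}&V_{12}\\V_{21}&V_{22}\end{pmatrix}$, where $V_{11}=\operatorname{var}(X)$ and $V_{22}=\operatorname{var}(Y)$ are non-singular. Then $D(X:Y)=\lambda(\Sigma)$, where $\lambda(\Sigma)$ is the maximal eigenvalue of $\Sigma=V_{11}^{-1/2}V_{12}V_{22}^{-1}V_{21}V_{11}^{-1/2}$. (ix) For an arbitrary $(m+n)$-dimensional random vector $(X,Y)$ with square-integrable components and covariance matrix as in (viii), $D(X:Y)\ge\lambda(\Sigma)$. (x) Let $X$ be a random element and $Y,Z$ real random variables. If $Z$ is self-decomposable and independent of the pair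 $(X,Y)$, then $\lambda\mapsto D(X:Y+\lambda Z)$ is non-decreasing on $(-\infty,0)$ and non-increasing on $(0,\infty)$. (xi) $D(X:Y)=R(X,Y)^2$. (xii) $D(X:Y)=D(Y:X)$. By (xi), parts (vi)–(ix) say that the maximal correlation $R$ equals (respectively, is at least) $|\rho|$ and $\sqrt{\lambda(\Sigma)}$. -/

import Mathlib

open MeasureTheory ProbabilityTheory Set
open scoped MatrixOrder

noncomputable section

/-- The dependence measure `D(X : Y)`: the supremum of `var E{φ(X) | Y}` over all (measurable)
`φ` with `‖φ‖² = E{φ(X)²} = 1`. -/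
def depMeasure {Ω S T : Type*} [MeasurableSpace Ω] [MeasurableSpace S] [mT : MeasurableSpace T]
    (P : Measure Ω) (X : Ω → S) (Y : Ω → T) : ℝ :=
  sSup {v : ℝ | ∃ φ : S → ℝ, Measurable φ ∧ MemLp (fun ω => φ (X ω)) 2 P ∧
    ∫ ω, φ (X ω) ^ 2 ∂P = 1 ∧
    v = variance (P[fun ω => φ (X ω) | mT.comap Y]) P}

/-- The Pearson correlation coefficient of two real random variables. -/
def pearsonCorr {Ω : Type*} [MeasurableSpace Ω] (P : Measure Ω) (U V : Ω → ℝ) : ℝ :=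
  covariance U V P / (Real.sqrt (variance U P) * Real.sqrt (variance V P))

/-- The maximal correlation `R(X, Y)`: the supremum of the correlation of `φ(X)` and `ψ(Y)` over
all (measurable) `φ`, `ψ` for which both variances are finite and positive. The supremum of the
empty set (no such pair exists if `X` or `Y` is degenerate) is `0`. -/
def maxCorr {Ω S T : Type*} [MeasurableSpace Ω] [MeasurableSpace S] [MeasurableSpace T]
    (P : Measure Ω) (X : Ω → S) (Y : Ω → T) : ℝ :=
  sSup {r : ℝ | ∃ (φ : S → ℝ) (ψ : T → ℝ), Measurable φ ∧ Measurable ψ ∧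
    MemLp (fun ω => φ (X ω)) 2 P ∧ 0 < variance (fun ω => φ (X ω)) P ∧
    MemLp (fun ω => ψ (Y ω)) 2 P ∧ 0 < variance (fun ω => ψ (Y ω)) P ∧
    r = pearsonCorr P (fun ω => φ (X ω)) (fun ω => ψ (Y ω))}

/-- A probability law `ν` on the line is self-decomposable if, for every `0 < c < 1`, it is the law
of `c Z + Z_c` where `Z` has law `ν` and `Z_c` is some random variable independent of `Z`. -/
def IsSelfDecomposable (ν : Measure ℝ) : Prop :=
  ∀ c : ℝ, 0 < c → c < 1 →
    ∃ ρ : Measure ℝ, IsProbabilityMeasure ρ ∧ ν = (ν.map (fun z => c * z)).conv ρ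

/-- The matrix of covariances of the components of two random vectors. -/
def covMat {Ω : Type*} [MeasurableSpace Ω] {m n : ℕ} (P : Measure Ω)
    (X : Ω → Fin m → ℝ) (Y : Ω → Fin n → ℝ) : Matrix (Fin m) (Fin n) ℝ :=
  Matrix.of fun i j => covariance (fun ω => X ω i) (fun ω => Y ω j) P

/-- `Σ = V₁₁^{-1/2} V₁₂ V₂₂⁻¹ V₂₁ V₁₁^{-1/2}`, the power `-1/2` being the positive semidefinite
square root of the inverse. -/
def canonMat {Ω : Type*} [MeasurableSpace Ω] {m n : ℕ} (P : Measure Ω)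
    (X : Ω → Fin m → ℝ) (Y : Ω → Fin n → ℝ) : Matrix (Fin m) (Fin m) ℝ :=
  CFC.sqrt (covMat P X X)⁻¹ * covMat P X Y * (covMat P Y Y)⁻¹ * covMat P Y X *
    CFC.sqrt (covMat P X X)⁻¹

/-- `l` is the maximal (real) eigenvalue of the square matrix `A`. -/
def IsMaxEigenvalue {m : ℕ} (A : Matrix (Fin m) (Fin m) ℝ) (l : ℝ) : Prop :=
  IsGreatest {t : ℝ | Module.End.HasEigenvalue (Matrix.toLin' A) t} l

end

/-! D(X:Y) is the least c ≥ 0 with cov(φ(X), ψ(Y))² ≤ c · var φ(X) · var ψ(Y) for all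
square-integrable φ(X), ψ(Y). Since cov(φ(X), ψ(Y)) = cov(E{φ(X)|Y}, ψ(Y)), Cauchy–Schwarz gives one
half (`covariance_sq_le_depMeasure`), and the test function ψ(Y) = E{φ(X)|Y} gives the other
(`depMeasure_le`). This form is symmetric, is inherited by functions of X and of Y, depends only on
the joint law and can be tested on bounded functions. Parts (i)–(iv), (vii), (xi) and (xii) follow
with little more.

For (v), averaging an independent Z out of ψ(Y, Z) keeps the covariance with φ(X) and can only lower
the variance. For (x), Y + tZ has, jointly with X, the law of (Y + ctZ) + tZ_c, a function of Y +
ctZ and independent noise.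

The Gaussian upper bound comes from convolution semigroups. Let S_r have stationary independent
increments and V(r) = E[E{φ(S_1)|S_r}²]. Splitting an increment into two i.i.d. halves and applying
Bessel's inequality gives 2V(a+δ) ≤ V(a) + V(a+2δ), so V lies below its chord on [0,1]; hence D(S_1
: S_s) ≤ s (`depMeasure_conv_semigroup_le`). If Σ ≤ s with 0 < s ≤ 1, the centred pair (X, Y) has
the law of (A S_s + noise, S_1), where S_r ~ N(0, rV₂₂), A = s⁻¹V₁₂V₂₂⁻¹ and the noise is
independent; so D(X:Y) ≤ s. Conversely an eigenvector of Σ yields linear functions of X and Y that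
witness its eigenvalue, with no Gaussian assumption; this is (ix). -/

section Covariance

/-! ### Covariance and conditional expectation. -/

variable {Ω : Type*} {mΩ : MeasurableSpace Ω} {P : Measure Ω}

/-- The Cauchy–Schwarz inequality for the covariance. -/
lemma covariance_sq_le [IsFiniteMeasure P] {U V : Ω → ℝ} (hU : MemLp U 2 P) (hV : MemLp V 2 P) :
    covariance U V P ^ 2 ≤ variance U P * variance V P := by
  have h : ∀ t : ℝ, 0 ≤ variance V P * (t * t) + 2 * covariance U V P * t + variance U P := by
    intro t
    have h0 := variance_nonneg (U + t • V) P
    rw [variance_add hU (hV.const_smul t), variance_smul, covariance_smul_right] at h0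
    nlinarith
  have := discrim_le_zero h
  rw [discrim] at this
  nlinarith

lemma memLp_of_abs_le [IsFiniteMeasure P] {U : Ω → ℝ} (hU : Measurable U) {C : ℝ}
    (hC : ∀ ω, |U ω| ≤ C) (p : ENNReal) : MemLp U p P :=
  MemLp.of_bound hU.aestronglyMeasurable C (Filter.Eventually.of_forall hC)

/-- The covariance with an `m`-measurable variable only depends on the conditional
expectation given `m`. -/
lemma covariance_condExp_left [IsProbabilityMeasure P] {m : MeasurableSpace Ω}
    (hm : m ≤ mΩ) {U V : Ω → ℝ} (hU : MemLp U 2 P) (hV : MemLp V 2 P)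
    (hVm : StronglyMeasurable[m] V) :
    covariance (P[U | m]) V P = covariance U V P := by
  have hE : MemLp (P[U | m]) 2 P := hU.condExp one_le_two
  have h1 : ∫ ω, (P[U | m]) ω ∂P = ∫ ω, U ω ∂P := integral_condExp hm
  have h2 : ∫ ω, (P[U | m] * V) ω ∂P = ∫ ω, (U * V) ω ∂P := by
    rw [← integral_condExp hm (f := U * V)]
    exact integral_congr_ae (condExp_mul_of_stronglyMeasurable_right hVm (hU.integrable_mul hV)
      (hU.integrable one_le_two)).symm
  rw [covariance_eq_sub hE hV, covariance_eq_sub hU hV, h1, h2]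

lemma covariance_congr_ae {U U' V V' : Ω → ℝ} (hU : U =ᵐ[P] U') (hV : V =ᵐ[P] V') :
    covariance U V P = covariance U' V' P := by
  rw [covariance, covariance, integral_congr_ae hU, integral_congr_ae hV]
  refine integral_congr_ae ?_
  filter_upwards [hU, hV] with ω h1 h2
  rw [h1, h2]

end Covariance

/-! ### The variational characterisation of D by squared covariances. -/

section Basic

variable {Ω S T : Type*} [mΩ : MeasurableSpace Ω] [mS : MeasurableSpace S] [mT : MeasurableSpace T]
  {P : Measure Ω} [IsProbabilityMeasure P] {X : Ω → S} {Y : Ω → T}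

/-- A bound on squared covariances bounds the variances of conditional expectations. -/
lemma variance_condExp_le {c : ℝ} (hc : 0 ≤ c) (hY : Measurable Y) {U : Ω → ℝ} (hU : MemLp U 2 P)
    (h : ∀ ψ : T → ℝ, Measurable ψ → MemLp (fun ω => ψ (Y ω)) 2 P →
      covariance U (fun ω => ψ (Y ω)) P ^ 2 ≤ c * variance U P * variance (fun ω => ψ (Y ω)) P) :
    variance (P[U | mT.comap Y]) P ≤ c * variance U P := by
  have hE : MemLp (P[U | mT.comap Y]) 2 P := hU.condExp one_le_two
  have hEm : StronglyMeasurable[mT.comap Y] (P[U | mT.comap Y]) := stronglyMeasurable_condExp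
  -- The extremal test function: E{U|Y} is itself some ψ(Y), and its covariance with U is its own
  -- variance v, so the hypothesis reads v² ≤ c · var U · v.
  obtain ⟨ψ, hψ, hψY⟩ := hEm.measurable.exists_eq_measurable_comp
  have hcov := covariance_condExp_left hY.comap_le hU hE hEm
  rw [covariance_self hE.aemeasurable] at hcov
  set E := P[U | mT.comap Y] with hEdef
  have h2 : (fun ω => ψ (Y ω)) = E := hψY.symm
  have h1 := h ψ hψ (h2 ▸ hE)
  rw [h2, ← hcov] at h1
  rcases (variance_nonneg E P).eq_or_lt with h0 | h0
  · rw [← h0]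
    exact mul_nonneg hc (variance_nonneg U P)
  · rw [sq] at h1
    exact le_of_mul_le_mul_right h1 h0

lemma variance_condExp_le_variance (hY : Measurable Y) {U : Ω → ℝ} (hU : MemLp U 2 P) :
    variance (P[U | mT.comap Y]) P ≤ variance U P := by
  simpa using variance_condExp_le zero_le_one hY hU
    fun ψ _ hψ2 => by simpa using covariance_sq_le hU hψ2

lemma variance_le_one_of_integral_sq {U : Ω → ℝ} (hU : MemLp U 2 P)
    (h1 : ∫ ω, U ω ^ 2 ∂P = 1) : variance U P ≤ 1 := by
  have := variance_le_expectation_sq (μ := P) hU.aestronglyMeasurable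
  simpa [h1] using this

/-- Makes the real `sSup` a genuine supremum, as `le_csSup` requires. -/
lemma depMeasure_bddAbove (P : Measure Ω) [IsProbabilityMeasure P] (X : Ω → S) {Y : Ω → T}
    (hY : Measurable Y) :
    BddAbove {v : ℝ | ∃ φ : S → ℝ, Measurable φ ∧ MemLp (fun ω => φ (X ω)) 2 P ∧
      ∫ ω, φ (X ω) ^ 2 ∂P = 1 ∧ v = variance (P[fun ω => φ (X ω) | mT.comap Y]) P} := by
  refine ⟨1, ?_⟩
  rintro v ⟨φ, -, hφ, h1, rfl⟩
  exact (variance_condExp_le_variance hY hφ).trans (variance_le_one_of_integral_sq hφ h1)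

lemma depMeasure_nonneg (P : Measure Ω) (X : Ω → S) (Y : Ω → T) : 0 ≤ depMeasure P X Y :=
  Real.sSup_nonneg (by rintro v ⟨φ, -, -, -, rfl⟩; exact variance_nonneg _ _)

/-- The measure of dependence bounds every squared covariance. -/
lemma covariance_sq_le_depMeasure (hY : Measurable Y) {φ : S → ℝ} {ψ : T → ℝ}
    (hφ : Measurable φ) (hψ : Measurable ψ) (hφX : MemLp (fun ω => φ (X ω)) 2 P)
    (hψY : MemLp (fun ω => ψ (Y ω)) 2 P) :
    covariance (fun ω => φ (X ω)) (fun ω => ψ (Y ω)) P ^ 2 ≤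
      depMeasure P X Y * (variance (fun ω => φ (X ω)) P * variance (fun ω => ψ (Y ω)) P) := by
  rcases (variance_nonneg (fun ω => φ (X ω)) P).eq_or_lt with h0 | h0
  · have := covariance_sq_le hφX hψY
    rw [← h0] at this ⊢
    simpa using this
  set v := variance (fun ω => φ (X ω)) P with hv
  set M := ∫ ω, φ (X ω) ∂P with hM
  -- Standardisation: with mean zero the second moment equals the variance, so φ' is admissible in
  -- the definition of D.
  let φ' : S → ℝ := fun x => (√v)⁻¹ * (φ x - M)
  have hs : 0 < √v := Real.sqrt_pos.2 h0
  have hφ'm : Measurable φ' := by fun_prop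
  have hφ'2 : MemLp (fun ω => φ' (X ω)) 2 P := (hφX.sub (memLp_const M)).const_mul _
  have hint : ∫ ω, φ' (X ω) ∂P = 0 := by
    simp only [φ']
    rw [integral_const_mul, integral_sub (hφX.integrable one_le_two) (integrable_const _)]
    simp [hM]
  have hvar : variance (fun ω => φ' (X ω)) P = 1 := by
    simp only [φ']
    rw [variance_const_mul, variance_sub_const hφX.aestronglyMeasurable, ← hv, inv_pow,
      Real.sq_sqrt h0.le, inv_mul_cancel₀ h0.ne']
  have hone : ∫ ω, φ' (X ω) ^ 2 ∂P = 1 := by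
    rw [← variance_of_integral_eq_zero hφ'2.aemeasurable hint, hvar]
  have hcov : covariance (fun ω => φ (X ω)) (fun ω => ψ (Y ω)) P =
      √v * covariance (fun ω => φ' (X ω)) (fun ω => ψ (Y ω)) P := by
    simp only [φ']
    rw [covariance_const_mul_left, covariance_sub_const_left (hφX.integrable one_le_two),
      mul_inv_cancel_left₀ hs.ne']
  have hψm : StronglyMeasurable[mT.comap Y] (fun ω => ψ (Y ω)) :=
    (hψ.comp (comap_measurable Y)).stronglyMeasurable
  rw [hcov, ← covariance_condExp_left hY.comap_le hφ'2 hψY hψm, mul_pow, Real.sq_sqrt h0.le]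
  have h1 := covariance_sq_le (hφ'2.condExp (m := mT.comap Y) one_le_two) hψY
  have h2 : variance (P[fun ω => φ' (X ω) | mT.comap Y]) P ≤ depMeasure P X Y :=
    le_csSup (depMeasure_bddAbove P X hY) ⟨φ', hφ'm, hφ'2, hone, rfl⟩
  calc _ ≤ v * (depMeasure P X Y * variance (fun ω => ψ (Y ω)) P) :=
        mul_le_mul_of_nonneg_left
          (h1.trans (mul_le_mul_of_nonneg_right h2 (variance_nonneg _ _))) h0.le
    _ = _ := by ring

/-- The converse half of the characterisation. Admissible φ need not be centred; second moment 1
still bounds the variance by 1, which suffices as c ≥ 0. -/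
lemma depMeasure_le {c : ℝ} (hc : 0 ≤ c) (hY : Measurable Y)
    (h : ∀ (φ : S → ℝ) (ψ : T → ℝ), Measurable φ → Measurable ψ →
      MemLp (fun ω => φ (X ω)) 2 P → MemLp (fun ω => ψ (Y ω)) 2 P →
      covariance (fun ω => φ (X ω)) (fun ω => ψ (Y ω)) P ^ 2 ≤
        c * (variance (fun ω => φ (X ω)) P * variance (fun ω => ψ (Y ω)) P)) :
    depMeasure P X Y ≤ c := by
  refine Real.sSup_le ?_ hc
  rintro v ⟨φ, hφ, hφX, h1, rfl⟩
  have := variance_condExp_le hc hY hφX fun ψ hψ hψY => by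
    simpa [mul_assoc] using h φ ψ hφ hψ hφX hψY
  exact this.trans (mul_le_of_le_one_right hc (variance_le_one_of_integral_sq hφX h1))

/-- Truncation of a real function at height `n`. -/
def truncFun {S : Type*} (φ : S → ℝ) (n : ℕ) (x : S) : ℝ := max (-(n : ℝ)) (min (φ x) n)

lemma abs_truncFun_le_nat {S : Type*} (φ : S → ℝ) (n : ℕ) (x : S) : |truncFun φ n x| ≤ n := by
  rw [truncFun, abs_le]
  have : (0 : ℝ) ≤ n := n.cast_nonneg
  exact ⟨le_max_left _ _, max_le (by linarith) (min_le_right _ _)⟩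

lemma abs_truncFun_le {S : Type*} (φ : S → ℝ) (n : ℕ) (x : S) : |truncFun φ n x| ≤ |φ x| := by
  have : (0 : ℝ) ≤ n := n.cast_nonneg
  rw [truncFun]
  rcases le_total (φ x) 0 with h | h
  · rw [min_eq_left (by linarith), abs_of_nonpos h,
      abs_of_nonpos (max_le (by linarith) h)]
    exact neg_le_neg (le_max_right _ _)
  · rw [max_eq_right (by linarith [le_min h this]), abs_of_nonneg h, abs_of_nonneg (le_min h this)]
    exact min_le_left _ _

lemma tendsto_truncFun {S : Type*} (φ : S → ℝ) (x : S) :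
    Filter.Tendsto (fun n => truncFun φ n x) Filter.atTop (nhds (φ x)) := by
  obtain ⟨N, hN⟩ := exists_nat_ge |φ x|
  refine tendsto_const_nhds.congr' ?_
  filter_upwards [Filter.eventually_ge_atTop N] with n hn
  have h1 : |φ x| ≤ n := hN.trans (by exact_mod_cast hn)
  rw [abs_le] at h1
  rw [truncFun, min_eq_left h1.2, max_eq_right h1.1]

lemma measurable_truncFun {φ : S → ℝ} (hφ : Measurable φ) (n : ℕ) :
    Measurable (truncFun φ n) := by
  unfold truncFun; fun_prop

/-- Dominated convergence in each of the three integrals. Taking both variables and both functions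
equal covers variances too. -/
lemma tendsto_covariance_truncFun {φ : S → ℝ} {ψ : T → ℝ} (hX : Measurable X) (hY : Measurable Y)
    (hφ : Measurable φ) (hψ : Measurable ψ) (hφX : MemLp (fun ω => φ (X ω)) 2 P)
    (hψY : MemLp (fun ω => ψ (Y ω)) 2 P) :
    Filter.Tendsto (fun n => covariance (fun ω => truncFun φ n (X ω))
      (fun ω => truncFun ψ n (Y ω)) P) Filter.atTop
      (nhds (covariance (fun ω => φ (X ω)) (fun ω => ψ (Y ω)) P)) := by
  have hmX : ∀ n, Measurable fun ω => truncFun φ n (X ω) :=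
    fun n => (measurable_truncFun hφ n).comp hX
  have hmY : ∀ n, Measurable fun ω => truncFun ψ n (Y ω) :=
    fun n => (measurable_truncFun hψ n).comp hY
  have h2 : ∀ n, MemLp (fun ω => truncFun φ n (X ω)) 2 P := fun n =>
    memLp_of_abs_le (hmX n) (fun ω => abs_truncFun_le_nat φ n (X ω)) 2
  have h2' : ∀ n, MemLp (fun ω => truncFun ψ n (Y ω)) 2 P := fun n =>
    memLp_of_abs_le (hmY n) (fun ω => abs_truncFun_le_nat ψ n (Y ω)) 2
  simp_rw [fun n => covariance_eq_sub (h2 n) (h2' n), covariance_eq_sub hφX hψY]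
  refine Filter.Tendsto.sub ?_ (Filter.Tendsto.mul ?_ ?_)
  · refine tendsto_integral_of_dominated_convergence (fun ω => |φ (X ω)| * |ψ (Y ω)|)
      (fun n => ((hmX n).mul (hmY n)).aestronglyMeasurable)
      (hφX.abs.integrable_mul hψY.abs) ?_ ?_
    · intro n
      refine Filter.Eventually.of_forall fun ω => ?_
      rw [Pi.mul_apply, Real.norm_eq_abs, abs_mul]
      exact mul_le_mul (abs_truncFun_le _ _ _) (abs_truncFun_le _ _ _) (abs_nonneg _) (abs_nonneg _)
    · exact Filter.Eventually.of_forall fun ω =>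
        (tendsto_truncFun φ (X ω)).mul (tendsto_truncFun ψ (Y ω))
  · exact tendsto_integral_of_dominated_convergence (fun ω => |φ (X ω)|)
      (fun n => (hmX n).aestronglyMeasurable) (hφX.abs.integrable one_le_two)
      (fun n => Filter.Eventually.of_forall fun ω => abs_truncFun_le _ _ _)
      (Filter.Eventually.of_forall fun ω => tendsto_truncFun φ (X ω))
  · exact tendsto_integral_of_dominated_convergence (fun ω => |ψ (Y ω)|)
      (fun n => (hmY n).aestronglyMeasurable) (hψY.abs.integrable one_le_two)
      (fun n => Filter.Eventually.of_forall fun ω => abs_truncFun_le _ _ _)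
      (Filter.Eventually.of_forall fun ω => tendsto_truncFun ψ (Y ω))

/-- To bound the measure of dependence it suffices to consider bounded functions. -/
lemma depMeasure_le_of_bounded {c : ℝ} (hc : 0 ≤ c) (hX : Measurable X) (hY : Measurable Y)
    (h : ∀ (φ : S → ℝ) (ψ : T → ℝ) (C : ℝ), Measurable φ → Measurable ψ →
      (∀ x, |φ x| ≤ C) → (∀ y, |ψ y| ≤ C) →
      covariance (fun ω => φ (X ω)) (fun ω => ψ (Y ω)) P ^ 2 ≤
        c * (variance (fun ω => φ (X ω)) P * variance (fun ω => ψ (Y ω)) P)) :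
    depMeasure P X Y ≤ c := by
  refine depMeasure_le hc hY fun φ ψ hφ hψ hφX hψY => ?_
  have hv : ∀ n, covariance (fun ω => truncFun φ n (X ω)) (fun ω => truncFun ψ n (Y ω)) P ^ 2 ≤
      c * (covariance (fun ω => truncFun φ n (X ω)) (fun ω => truncFun φ n (X ω)) P *
        covariance (fun ω => truncFun ψ n (Y ω)) (fun ω => truncFun ψ n (Y ω)) P) := by
    intro n
    rw [covariance_self (X := fun ω => truncFun φ n (X ω))
        ((measurable_truncFun hφ n).comp hX).aemeasurable,
      covariance_self (X := fun ω => truncFun ψ n (Y ω))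
        ((measurable_truncFun hψ n).comp hY).aemeasurable]
    exact h _ _ n (measurable_truncFun hφ n) (measurable_truncFun hψ n)
      (abs_truncFun_le_nat φ n) (abs_truncFun_le_nat ψ n)
  rw [← covariance_self hφX.aemeasurable, ← covariance_self hψY.aemeasurable]
  exact le_of_tendsto_of_tendsto'
    ((tendsto_covariance_truncFun hX hY hφ hψ hφX hψY).pow 2)
    (((tendsto_covariance_truncFun hX hX hφ hφ hφX hφX).mul
      (tendsto_covariance_truncFun hY hY hψ hψ hψY hψY)).const_mul c) hv

end Basic

/-! ### Symmetry, data processing, dependence on the law, extreme values, maximal correlation. -/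

section Consequences

variable {Ω S T : Type*} [mΩ : MeasurableSpace Ω] [mS : MeasurableSpace S] [mT : MeasurableSpace T]
  {P : Measure Ω} [IsProbabilityMeasure P] {X : Ω → S} {Y : Ω → T}

lemma depMeasure_le_one (hY : Measurable Y) : depMeasure P X Y ≤ 1 :=
  depMeasure_le zero_le_one hY fun _ _ _ _ h1 h2 => by simpa using covariance_sq_le h1 h2

lemma depMeasure_le_swap (hX : Measurable X) (hY : Measurable Y) :
    depMeasure P X Y ≤ depMeasure P Y X :=
  depMeasure_le (depMeasure_nonneg _ _ _) hY fun φ ψ hφ hψ h1 h2 => by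
    rw [covariance_comm, mul_comm (variance _ _)]
    exact covariance_sq_le_depMeasure hX hψ hφ h2 h1

lemma depMeasure_comm (hX : Measurable X) (hY : Measurable Y) :
    depMeasure P X Y = depMeasure P Y X :=
  (depMeasure_le_swap hX hY).antisymm (depMeasure_le_swap hY hX)

/-- Data processing inequality. -/
lemma depMeasure_comp_le {S' T' : Type*} [MeasurableSpace S'] [MeasurableSpace T']
    (hY : Measurable Y) {f : S → S'} {g : T → T'} (hf : Measurable f) (hg : Measurable g) :
    depMeasure P (fun ω => f (X ω)) (fun ω => g (Y ω)) ≤ depMeasure P X Y :=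
  depMeasure_le (depMeasure_nonneg _ _ _) (hg.comp hY) fun _ _ hφ hψ h1 h2 =>
    covariance_sq_le_depMeasure hY (hφ.comp hf) (hψ.comp hg) h1 h2

/-- Covariances and variances are computed under the joint law; bounded test functions make
square-integrability automatic on both spaces. -/
lemma depMeasure_le_of_map_eq {Ω' : Type*} [MeasurableSpace Ω'] {Q : Measure Ω'}
    [IsProbabilityMeasure Q] {X' : Ω' → S} {Y' : Ω' → T} (hX : Measurable X) (hY : Measurable Y)
    (hX' : Measurable X') (hY' : Measurable Y')
    (h : P.map (fun ω => (X ω, Y ω)) = Q.map (fun ω => (X' ω, Y' ω))) :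
    depMeasure P X Y ≤ depMeasure Q X' Y' := by
  refine depMeasure_le_of_bounded (depMeasure_nonneg _ _ _) hX hY fun φ ψ C hφ hψ hφC hψC => ?_
  have key := covariance_sq_le_depMeasure (P := Q) (X := X') hY' hφ hψ
    (memLp_of_abs_le (hφ.comp hX') (fun ω => hφC _) 2)
    (memLp_of_abs_le (hψ.comp hY') (fun ω => hψC _) 2)
  have hf : Measurable fun p : S × T => φ p.1 := by fun_prop
  have hg : Measurable fun p : S × T => ψ p.2 := by fun_prop
  have hXY : Measurable fun ω => (X ω, Y ω) := hX.prodMk hY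
  have hXY' : Measurable fun ω => (X' ω, Y' ω) := hX'.prodMk hY'
  have e1 := covariance_map_fun (μ := P) hf.aestronglyMeasurable hg.aestronglyMeasurable
    hXY.aemeasurable
  have e2 := covariance_map_fun (μ := Q) hf.aestronglyMeasurable hg.aestronglyMeasurable
    hXY'.aemeasurable
  have e3 := variance_map (μ := P) hf.aemeasurable hXY.aemeasurable
  have e4 := variance_map (μ := Q) hf.aemeasurable hXY'.aemeasurable
  have e5 := variance_map (μ := P) hg.aemeasurable hXY.aemeasurable
  have e6 := variance_map (μ := Q) hg.aemeasurable hXY'.aemeasurable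
  simp only [Function.comp_def] at e3 e4 e5 e6
  rwa [← e1, ← e3, ← e5, h, e2, e4, e6]

/-- The measure of dependence only depends on the joint law. -/
lemma depMeasure_eq_of_map_eq {Ω' : Type*} [MeasurableSpace Ω'] {Q : Measure Ω'}
    [IsProbabilityMeasure Q] {X' : Ω' → S} {Y' : Ω' → T} (hX : Measurable X) (hY : Measurable Y)
    (hX' : Measurable X') (hY' : Measurable Y')
    (h : P.map (fun ω => (X ω, Y ω)) = Q.map (fun ω => (X' ω, Y' ω))) :
    depMeasure P X Y = depMeasure Q X' Y' :=
  (depMeasure_le_of_map_eq hX hY hX' hY' h).antisymm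
    (depMeasure_le_of_map_eq hX' hY' hX hY h.symm)

lemma measurable_indicator_one {A : Set S} (hA : MeasurableSet A) :
    Measurable (A.indicator fun _ => (1 : ℝ)) := measurable_const.indicator hA

lemma memLp_indicator_one_comp (hX : Measurable X) {A : Set S} (hA : MeasurableSet A) :
    MemLp (fun ω => A.indicator (fun _ => (1 : ℝ)) (X ω)) 2 P :=
  memLp_of_abs_le ((measurable_indicator_one hA).comp hX) (C := 1)
    (fun ω => by by_cases h : X ω ∈ A <;> simp [h]) 2

omit [IsProbabilityMeasure P] in
lemma integral_indicator_one_comp (hX : Measurable X) {A : Set S} (hA : MeasurableSet A) :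
    ∫ ω, A.indicator (fun _ => (1 : ℝ)) (X ω) ∂P = P.real (X ⁻¹' A) := by
  rw [← integral_indicator_one (hX hA)]
  rfl

/-- Testing on indicators already gives independence, since their covariance is P(X∈A, Y∈B) −
P(X∈A)P(Y∈B). -/
lemma depMeasure_eq_zero_iff (hX : Measurable X) (hY : Measurable Y) :
    depMeasure P X Y = 0 ↔ IndepFun X Y P := by
  refine ⟨fun h => ?_, fun h => ?_⟩
  · rw [indepFun_iff_measure_inter_preimage_eq_mul]
    intro A B hA hB
    have h1 := covariance_sq_le_depMeasure hY (measurable_indicator_one hA)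
      (measurable_indicator_one hB) (memLp_indicator_one_comp (P := P) hX hA)
      (memLp_indicator_one_comp hY hB)
    rw [h, zero_mul] at h1
    have h2 := pow_eq_zero_iff (two_ne_zero) |>.1 (h1.antisymm (sq_nonneg _))
    rw [covariance_eq_sub (memLp_indicator_one_comp hX hA) (memLp_indicator_one_comp hY hB),
      integral_indicator_one_comp hX hA, integral_indicator_one_comp hY hB, sub_eq_zero] at h2
    have h3 : ∫ ω, ((fun ω => A.indicator (fun _ => (1 : ℝ)) (X ω)) *
        (fun ω => B.indicator (fun _ => (1 : ℝ)) (Y ω))) ω ∂P = P.real (X ⁻¹' A ∩ Y ⁻¹' B) := by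
      rw [← integral_indicator_one ((hX hA).inter (hY hB))]
      congr 1
      ext ω
      by_cases ha : X ω ∈ A <;> by_cases hb : Y ω ∈ B <;> simp [ha, hb]
    rw [h3] at h2
    rwa [← ENNReal.toReal_eq_toReal_iff' (by finiteness) (by finiteness), ENNReal.toReal_mul]
  · refine (depMeasure_le le_rfl hY fun φ ψ hφ hψ h1 h2 => ?_).antisymm (depMeasure_nonneg _ _ _)
    have : IndepFun (fun ω => φ (X ω)) (fun ω => ψ (Y ω)) P := h.comp hφ hψ
    rw [this.covariance_eq_zero h1 h2]
    simp

/-- If a nontrivial event is almost surely determined both by `X` and by `Y`, then the measure of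
dependence is maximal. -/
lemma depMeasure_eq_one (hX : Measurable X) (hY : Measurable Y) {A : Set S} {B : Set T}
    (hA : MeasurableSet A) (hB : MeasurableSet B) (h : ∀ᵐ ω ∂P, X ω ∈ A ↔ Y ω ∈ B)
    (h0 : P (X ⁻¹' A) ≠ 0) (h1 : P (X ⁻¹' A) ≠ 1) : depMeasure P X Y = 1 := by
  refine (depMeasure_le_one hY).antisymm ?_
  have hφ := memLp_indicator_one_comp (P := P) hX hA
  have hae : (fun ω => B.indicator (fun _ => (1 : ℝ)) (Y ω)) =ᵐ[P]
      fun ω => A.indicator (fun _ => (1 : ℝ)) (X ω) := by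
    filter_upwards [h] with ω hω
    by_cases ha : X ω ∈ A
    · simp [ha, hω.1 ha]
    · simp [ha, mt hω.2 ha]
  have key := covariance_sq_le_depMeasure hY (measurable_indicator_one hA)
    (measurable_indicator_one hB) hφ (memLp_indicator_one_comp hY hB)
  rw [covariance_congr_ae Filter.EventuallyEq.rfl hae, variance_congr hae,
    covariance_self hφ.aemeasurable] at key
  have hv : variance (fun ω => A.indicator (fun _ => (1 : ℝ)) (X ω)) P =
      P.real (X ⁻¹' A) * (1 - P.real (X ⁻¹' A)) := by
    have hsq : (fun ω => A.indicator (fun _ => (1 : ℝ)) (X ω)) ^ 2 =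
        fun ω => A.indicator (fun _ => (1 : ℝ)) (X ω) := by
      ext ω; by_cases ha : X ω ∈ A <;> simp [ha]
    rw [variance_eq_sub hφ, hsq, integral_indicator_one_comp hX hA]
    ring
  have hp0 : 0 < P.real (X ⁻¹' A) := by
    rw [measureReal_def]; exact ENNReal.toReal_pos h0 (by finiteness)
  have hp1 : P.real (X ⁻¹' A) < 1 := by
    refine lt_of_le_of_ne measureReal_le_one fun h => h1 ?_
    rwa [measureReal_def, ENNReal.toReal_eq_one_iff] at h
  have hpos : 0 < variance (fun ω => A.indicator (fun _ => (1 : ℝ)) (X ω)) P := by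
    rw [hv]; exact mul_pos hp0 (by linarith)
  -- `key` says v² ≤ D · v² for the indicator's variance v > 0.
  nlinarith [mul_pos hpos hpos]

/-- A law on the plane with maximal dependence, whose first coordinate is not a function of the
second one. -/
lemma exists_depMeasure_eq_one_not_function :
    ∃ Q : Measure (ℝ × ℝ), IsProbabilityMeasure Q ∧
      depMeasure Q (Prod.fst : ℝ × ℝ → ℝ) (Prod.snd : ℝ × ℝ → ℝ) = 1 ∧
      ¬ ∃ h : ℝ → ℝ, Measurable h ∧ (Prod.fst : ℝ × ℝ → ℝ) =ᵐ[Q] fun p => h p.2 := by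
  -- The events {X = 0} and {Y = 0} agree and have probability 1/3, while Y = 1 leaves X = 1 and X =
  -- 2 both possible.
  let Q : Measure (ℝ × ℝ) := (3 : ENNReal)⁻¹ •
    (Measure.dirac (0, 0) + Measure.dirac (1, 1) + Measure.dirac (2, 1))
  have h3 : (3 : ENNReal)⁻¹ ≠ 0 := by simp
  have hQ : IsProbabilityMeasure Q := by
    refine ⟨?_⟩
    simp only [Q, Measure.smul_apply, Measure.add_apply, measure_univ, smul_eq_mul]
    rw [show (1 : ENNReal) + 1 + 1 = 3 by norm_num]
    exact ENNReal.inv_mul_cancel (by norm_num) (by norm_num)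
  have hae : ∀ p : ℝ × ℝ → Prop, (∀ᵐ x ∂Q, p x) ↔ p (0, 0) ∧ p (1, 1) ∧ p (2, 1) := by
    intro p
    simp only [Q, Measure.ae_ennreal_smul_measure_iff h3, ae_add_measure_iff, ae_dirac_eq,
      Filter.eventually_pure, and_assoc]
  have hval : Q (Prod.fst ⁻¹' {(0 : ℝ)}) = 3⁻¹ := by
    have : MeasurableSet (Prod.fst ⁻¹' {(0 : ℝ)} : Set (ℝ × ℝ)) :=
      measurable_fst (measurableSet_singleton _)
    simp [Q, Measure.dirac_apply' _ this]
  refine ⟨Q, hQ, ?_, ?_⟩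
  · refine depMeasure_eq_one measurable_fst measurable_snd (measurableSet_singleton (0 : ℝ))
      (measurableSet_singleton (0 : ℝ)) ((hae _).2 (by simp)) ?_ ?_
    · rw [hval]; exact h3
    · rw [hval]; simp
  · rintro ⟨h, -, hh⟩
    obtain ⟨-, h1, h2⟩ := (hae _).1 hh
    norm_num at h1 h2
    rw [← h1] at h2
    norm_num at h2

omit [IsProbabilityMeasure P] in
lemma pearsonCorr_sq_mul {U V : Ω → ℝ} (hU : 0 < variance U P) (hV : 0 < variance V P) :
    pearsonCorr P U V ^ 2 * (variance U P * variance V P) = covariance U V P ^ 2 := by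
  rw [pearsonCorr, div_pow, mul_pow, Real.sq_sqrt hU.le, Real.sq_sqrt hV.le,
    div_mul_cancel₀ _ (mul_pos hU hV).ne']

lemma pearsonCorr_sq_le_depMeasure (hY : Measurable Y) {φ : S → ℝ} {ψ : T → ℝ}
    (hφ : Measurable φ) (hψ : Measurable ψ) (hφX : MemLp (fun ω => φ (X ω)) 2 P)
    (hψY : MemLp (fun ω => ψ (Y ω)) 2 P) (h1 : 0 < variance (fun ω => φ (X ω)) P)
    (h2 : 0 < variance (fun ω => ψ (Y ω)) P) :
    pearsonCorr P (fun ω => φ (X ω)) (fun ω => ψ (Y ω)) ^ 2 ≤ depMeasure P X Y := by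
  refine le_of_mul_le_mul_right ?_ (mul_pos h1 h2)
  rw [pearsonCorr_sq_mul h1 h2]
  exact covariance_sq_le_depMeasure hY hφ hψ hφX hψY

/-- Replacing φ by −φ flips the sign of a correlation, so the signed supremum R also bounds absolute
values; for degenerate variables the covariance vanishes. -/
lemma depMeasure_eq_maxCorr_sq (hY : Measurable Y) :
    depMeasure P X Y = maxCorr P X Y ^ 2 := by
  have hbound : ∀ r ∈ {r : ℝ | ∃ (φ : S → ℝ) (ψ : T → ℝ), Measurable φ ∧ Measurable ψ ∧
      MemLp (fun ω => φ (X ω)) 2 P ∧ 0 < variance (fun ω => φ (X ω)) P ∧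
      MemLp (fun ω => ψ (Y ω)) 2 P ∧ 0 < variance (fun ω => ψ (Y ω)) P ∧
      r = pearsonCorr P (fun ω => φ (X ω)) (fun ω => ψ (Y ω))}, r ≤ √(depMeasure P X Y) := by
    rintro r ⟨φ, ψ, hφ, hψ, hφX, h1, hψY, h2, rfl⟩
    exact Real.le_sqrt_of_sq_le (pearsonCorr_sq_le_depMeasure hY hφ hψ hφX hψY h1 h2)
  refine le_antisymm (depMeasure_le (sq_nonneg _) hY fun φ ψ hφ hψ hφX hψY => ?_) ?_
  · rcases (variance_nonneg (fun ω => φ (X ω)) P).eq_or_lt with h1 | h1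
    · simpa [← h1] using covariance_sq_le hφX hψY
    rcases (variance_nonneg (fun ω => ψ (Y ω)) P).eq_or_lt with h2 | h2
    · simpa [← h2] using covariance_sq_le hφX hψY
    rw [← pearsonCorr_sq_mul h1 h2]
    refine mul_le_mul_of_nonneg_right ?_ (mul_pos h1 h2).le
    rw [← sq_abs]
    refine pow_le_pow_left₀ (abs_nonneg _) (abs_le'.2 ⟨?_, ?_⟩) 2
    · exact le_csSup ⟨_, hbound⟩ ⟨φ, ψ, hφ, hψ, hφX, h1, hψY, h2, rfl⟩
    · refine le_csSup ⟨_, hbound⟩ ⟨fun x => -φ x, ψ, hφ.neg, hψ, hφX.neg, ?_, hψY, h2, ?_⟩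
      · rwa [variance_fun_neg]
      · simp only [pearsonCorr, variance_fun_neg, covariance_fun_neg_left, neg_div]
  -- Squaring needs R ≥ 0: a negative supremum would make both r and −r negative, and the empty
  -- supremum is 0.
  · have h0 : 0 ≤ maxCorr P X Y := by
      rw [maxCorr]
      by_contra! hneg
      obtain ⟨r, ⟨φ, ψ, hφ, hψ, hφX, h1, hψY, h2, rfl⟩⟩ : {r : ℝ | ∃ (φ : S → ℝ) (ψ : T → ℝ),
          Measurable φ ∧ Measurable ψ ∧
          MemLp (fun ω => φ (X ω)) 2 P ∧ 0 < variance (fun ω => φ (X ω)) P ∧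
          MemLp (fun ω => ψ (Y ω)) 2 P ∧ 0 < variance (fun ω => ψ (Y ω)) P ∧
          r = pearsonCorr P (fun ω => φ (X ω)) (fun ω => ψ (Y ω))}.Nonempty := by
        by_contra hne
        rw [Set.not_nonempty_iff_eq_empty] at hne
        rw [hne, Real.sSup_empty] at hneg
        exact lt_irrefl _ hneg
      have e1 := (le_csSup ⟨_, hbound⟩ ⟨φ, ψ, hφ, hψ, hφX, h1, hψY, h2, rfl⟩).trans_lt hneg
      have e2 := (le_csSup ⟨_, hbound⟩ ⟨fun x => -φ x, ψ, hφ.neg, hψ, hφX.neg,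
        by rwa [variance_fun_neg], hψY, h2, rfl⟩).trans_lt hneg
      simp only [pearsonCorr, variance_fun_neg, covariance_fun_neg_left, neg_div] at e1 e2
      linarith
    have h1 : maxCorr P X Y ≤ √(depMeasure P X Y) := Real.sSup_le hbound (Real.sqrt_nonneg _)
    calc maxCorr P X Y ^ 2 ≤ √(depMeasure P X Y) ^ 2 := pow_le_pow_left₀ h0 h1 2
      _ = _ := Real.sq_sqrt (depMeasure_nonneg _ _ _)

end Consequences

/-! ### Independent components and self-decomposable noise. -/

section Independent

variable {Ω S T U : Type*} [mΩ : MeasurableSpace Ω] [mS : MeasurableSpace S] [mT : MeasurableSpace T]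
  [mU : MeasurableSpace U] {P : Measure Ω} [IsProbabilityMeasure P] {X : Ω → S} {Y : Ω → T}

lemma abs_integral_le_of_abs_le {μ : Measure S} [IsProbabilityMeasure μ] {f : S → ℝ} {C : ℝ}
    (h : ∀ x, |f x| ≤ C) : |∫ x, f x ∂μ| ≤ C := by
  simpa using norm_integral_le_of_norm_le_const (μ := μ) (f := f) (C := C)
    (Filter.Eventually.of_forall h)

lemma integrable_of_abs_le {μ : Measure S} [IsProbabilityMeasure μ] {f : S → ℝ} {C : ℝ}
    (hf : Measurable f) (h : ∀ x, |f x| ≤ C) : Integrable f μ :=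
  (memLp_of_abs_le hf h 1).integrable le_rfl

lemma sq_integral_le {μ : Measure S} [IsProbabilityMeasure μ] {f : S → ℝ} (hf : MemLp f 2 μ) :
    (∫ x, f x ∂μ) ^ 2 ≤ ∫ x, f x ^ 2 ∂μ := by
  have h := variance_nonneg f μ
  rw [variance_eq_sub hf] at h
  simpa using h

lemma abs_sq_le {a C : ℝ} (h : |a| ≤ C) : |a ^ 2| ≤ C ^ 2 := by
  rw [abs_pow]; exact pow_le_pow_left₀ (abs_nonneg _) h 2

/-- Adjoining an independent component does not increase the measure of dependence. -/
lemma depMeasure_prod_le (μ : Measure (S × T)) [IsProbabilityMeasure μ] (ν : Measure U)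
    [IsProbabilityMeasure ν] :
    depMeasure (μ.prod ν) (fun p => p.1.1) (fun p => (p.1.2, p.2)) ≤
      depMeasure μ Prod.fst Prod.snd := by
  refine depMeasure_le_of_bounded (depMeasure_nonneg _ _ _) (by fun_prop) (by fun_prop)
    fun φ ψ C hφ hψ hφC hψC => ?_
  -- Averaging over the independent component keeps the mean and the covariance with φ, by Fubini,
  -- and does not raise the second moment, by Jensen.
  let ψ' : T → ℝ := fun y => ∫ z, ψ (y, z) ∂ν
  have hψ' : Measurable ψ' := hψ.stronglyMeasurable.integral_prod_right'.measurable
  have hψ'C : ∀ y, |ψ' y| ≤ C := fun y => abs_integral_le_of_abs_le fun z => hψC _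
  have m1 : Measurable fun q : S × T => φ q.1 := by fun_prop
  have m2 : Measurable fun q : S × T => ψ' q.2 := by fun_prop
  have m3 : Measurable fun p : (S × T) × U => φ p.1.1 := by fun_prop
  have m4 : Measurable fun p : (S × T) × U => ψ (p.1.2, p.2) := by fun_prop
  have L1 : MemLp (fun q : S × T => φ q.1) 2 μ := memLp_of_abs_le m1 (fun q => hφC _) 2
  have L2 : MemLp (fun q : S × T => ψ' q.2) 2 μ := memLp_of_abs_le m2 (fun q => hψ'C _) 2
  have L3 : MemLp (fun p : (S × T) × U => φ p.1.1) 2 (μ.prod ν) :=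
    memLp_of_abs_le m3 (fun q => hφC _) 2
  have L4 : MemLp (fun p : (S × T) × U => ψ (p.1.2, p.2)) 2 (μ.prod ν) :=
    memLp_of_abs_le m4 (fun q => hψC _) 2
  have e1 : ∫ p, φ p.1.1 ∂(μ.prod ν) = ∫ q, φ q.1 ∂μ := by
    rw [integral_prod _ (L3.integrable one_le_two)]; simp
  have e2 : ∫ p, ψ (p.1.2, p.2) ∂(μ.prod ν) = ∫ q, ψ' q.2 ∂μ :=
    integral_prod _ (L4.integrable one_le_two)
  have e3 : ∫ p, φ p.1.1 * ψ (p.1.2, p.2) ∂(μ.prod ν) = ∫ q, φ q.1 * ψ' q.2 ∂μ := by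
    rw [integral_prod _ (by exact L3.integrable_mul L4)]
    simp only [integral_const_mul, ψ']
  have e4 : ∫ p, φ p.1.1 ^ 2 ∂(μ.prod ν) = ∫ q, φ q.1 ^ 2 ∂μ := by
    rw [integral_prod _ L3.integrable_sq]; simp
  have e5 : ∫ q, ψ' q.2 ^ 2 ∂μ ≤ ∫ p, ψ (p.1.2, p.2) ^ 2 ∂(μ.prod ν) := by
    rw [integral_prod _ L4.integrable_sq]
    refine integral_mono L2.integrable_sq L4.integrable_sq.integral_prod_left fun q => ?_
    exact sq_integral_le (memLp_of_abs_le (hψ.comp measurable_prodMk_left) (fun z => hψC _) 2)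
  have hcov : covariance (fun p : (S × T) × U => φ p.1.1)
      (fun p : (S × T) × U => ψ (p.1.2, p.2)) (μ.prod ν) =
      covariance (fun q : S × T => φ q.1) (fun q : S × T => ψ' q.2) μ := by
    rw [covariance_eq_sub L3 L4, covariance_eq_sub L1 L2, e1, e2]
    congr 1
  have hvar1 : variance (fun p : (S × T) × U => φ p.1.1) (μ.prod ν) =
      variance (fun q : S × T => φ q.1) μ := by
    rw [variance_eq_sub L3, variance_eq_sub L1, e1]
    congr 1
  have hvar2 : variance (fun q : S × T => ψ' q.2) μ ≤
      variance (fun p : (S × T) × U => ψ (p.1.2, p.2)) (μ.prod ν) := by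
    rw [variance_eq_sub L4, variance_eq_sub L2, e2]
    exact sub_le_sub_right e5 _
  rw [hcov, hvar1]
  exact (covariance_sq_le_depMeasure measurable_snd hφ hψ' L1 L2).trans
    (mul_le_mul_of_nonneg_left (mul_le_mul_of_nonneg_left hvar2 (variance_nonneg _ _))
      (depMeasure_nonneg _ _ _))

lemma depMeasure_prodMk_of_indepFun (hX : Measurable X) (hY : Measurable Y) {Z : Ω → U}
    (hZ : Measurable Z) (h : IndepFun (fun ω => (X ω, Y ω)) Z P) :
    depMeasure P X (fun ω => (Y ω, Z ω)) = depMeasure P X Y := by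
  have hXY : Measurable fun ω => (X ω, Y ω) := hX.prodMk hY
  have := Measure.isProbabilityMeasure_map (μ := P) hXY.aemeasurable
  have := Measure.isProbabilityMeasure_map (μ := P) hZ.aemeasurable
  refine le_antisymm ?_ (depMeasure_comp_le (f := id) (g := Prod.fst) (hY.prodMk hZ)
    measurable_id measurable_fst)
  have hlaw := (indepFun_iff_map_prod_eq_prod_map_map hXY.aemeasurable hZ.aemeasurable).1 h
  have h1 : depMeasure P X (fun ω => (Y ω, Z ω)) =
      depMeasure ((P.map fun ω => (X ω, Y ω)).prod (P.map Z)) (fun p => p.1.1)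
        (fun p => (p.1.2, p.2)) := by
    refine depMeasure_eq_of_map_eq hX (hY.prodMk hZ) (by fun_prop) (by fun_prop) ?_
    rw [← hlaw, Measure.map_map (by fun_prop) (hXY.prodMk hZ)]
    rfl
  have h2 : depMeasure P X Y = depMeasure (P.map fun ω => (X ω, Y ω)) Prod.fst Prod.snd := by
    refine depMeasure_eq_of_map_eq hX hY measurable_fst measurable_snd ?_
    simp
  rw [h1, h2]
  exact depMeasure_prod_le _ _

lemma depMeasure_add_mul_le_of_isSelfDecomposable (hX : Measurable X) {Y Z : Ω → ℝ}
    (hY : Measurable Y) (hZ : Measurable Z) (hsd : IsSelfDecomposable (P.map Z))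
    (h : IndepFun (fun ω => (X ω, Y ω)) Z P) {c : ℝ} (hc0 : 0 < c) (hc1 : c < 1) (t : ℝ) :
    depMeasure P X (fun ω => Y ω + t * Z ω) ≤ depMeasure P X (fun ω => Y ω + c * t * Z ω) := by
  obtain ⟨ρ, hρ, hν⟩ := hsd c hc0 hc1
  have hXY : Measurable fun ω => (X ω, Y ω) := hX.prodMk hY
  have := Measure.isProbabilityMeasure_map (μ := P) hXY.aemeasurable
  have := Measure.isProbabilityMeasure_map (μ := P) hZ.aemeasurable
  have hlaw := (indepFun_iff_map_prod_eq_prod_map_map hXY.aemeasurable hZ.aemeasurable).1 h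
  set μ := P.map fun ω => (X ω, Y ω) with hμ
  set ν := P.map Z with hνdef
  -- The enlarged space, with coordinates (((X, Y), Z), Z_c); here cZ + Z_c is a copy of Z
  -- independent of (X, Y).
  let Q : Measure (((S × ℝ) × ℝ) × ℝ) := (μ.prod ν).prod ρ
  have hν' : ν = (ν.prod ρ).map (fun q => c * q.1 + q.2) := by
    conv_lhs => rw [hν]
    rw [Measure.conv]
    have hc : Measurable fun z : ℝ => c * z := by fun_prop
    conv_lhs => rw [← Measure.map_id (μ := ρ)]
    rw [Measure.map_prod_map _ _ hc measurable_id, Measure.map_map (by fun_prop) (by fun_prop)]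
    rfl
  have hμν : μ.prod ν = Q.map (fun p => (p.1.1, c * p.1.2 + p.2)) := by
    conv_lhs => rw [hν']
    conv_lhs => rw [← Measure.map_id (μ := μ)]
    rw [Measure.map_prod_map _ _ measurable_id (by fun_prop),
      ← (measurePreserving_prodAssoc μ ν ρ).map_eq, Measure.map_map (by fun_prop) (by fun_prop)]
    rfl
  have h1 : depMeasure P X (fun ω => Y ω + t * Z ω) =
      depMeasure Q (fun p => p.1.1.1) (fun p => p.1.1.2 + t * (c * p.1.2 + p.2)) := by
    refine depMeasure_eq_of_map_eq hX (by fun_prop) (by fun_prop) (by fun_prop) ?_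
    have e1 : P.map (fun ω => (X ω, Y ω + t * Z ω)) =
        (μ.prod ν).map (fun p => (p.1.1, p.1.2 + t * p.2)) := by
      rw [← hlaw, Measure.map_map (by fun_prop) (hXY.prodMk hZ)]
      rfl
    rw [e1, hμν, Measure.map_map (by fun_prop) (by fun_prop)]
    rfl
  have h2 : depMeasure P X (fun ω => Y ω + c * t * Z ω) =
      depMeasure Q (fun p => p.1.1.1) (fun p => p.1.1.2 + c * t * p.1.2) := by
    refine depMeasure_eq_of_map_eq hX (by fun_prop) (by fun_prop) (by fun_prop) ?_
    have e1 : P.map (fun ω => (X ω, Y ω + c * t * Z ω)) =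
        (μ.prod ν).map (fun p => (p.1.1, p.1.2 + c * t * p.2)) := by
      rw [← hlaw, Measure.map_map (by fun_prop) (hXY.prodMk hZ)]
      rfl
    have e2 : μ.prod ν = Q.map Prod.fst := by simp [Q]
    rw [e1, e2, Measure.map_map (by fun_prop) (by fun_prop)]
    rfl
  have h3 : depMeasure Q (fun p => p.1.1.1) (fun p => (p.1.1.2 + c * t * p.1.2, p.2)) =
      depMeasure Q (fun p => p.1.1.1) (fun p => p.1.1.2 + c * t * p.1.2) := by
    refine depMeasure_prodMk_of_indepFun (by fun_prop) (by fun_prop) measurable_snd ?_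
    exact indepFun_prod (X := fun q : (S × ℝ) × ℝ => (q.1.1, q.1.2 + c * t * q.2))
      (Y := fun z : ℝ => z) (by fun_prop) (by fun_prop)
  -- With Z replaced by its copy, Y + t(cZ + Z_c) = (Y + ctZ) + tZ_c is a function of the pair (Y +
  -- ctZ, Z_c), so data processing applies.
  rw [h1, h2, ← h3]
  have := depMeasure_comp_le (P := Q) (X := fun p => p.1.1.1)
    (Y := fun p => (p.1.1.2 + c * t * p.1.2, p.2)) (f := id)
    (g := fun q : ℝ × ℝ => q.1 + t * q.2) (by fun_prop) measurable_id (by fun_prop)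
  refine le_of_eq_of_le ?_ this
  congr 1
  ext p
  ring

end Independent

/-! ### Dependence between two times of a convolution semigroup. -/

section ConvolutionSemigroup

variable {E : Type*} [MeasurableSpace E]

/-- Bessel's inequality for a symmetric kernel and its two marginal averages. -/
lemma two_mul_integral_sq_le (β : Measure E) [IsProbabilityMeasure β] {g : E × E → ℝ} {C : ℝ}
    (hg : Measurable g) (hC : ∀ p, |g p| ≤ C) (hsymm : ∀ a b, g (a, b) = g (b, a)) :
    2 * ∫ a, (∫ b, g (a, b) ∂β) ^ 2 ∂β ≤ ∫ p, g p ^ 2 ∂(β.prod β) + (∫ p, g p ∂(β.prod β)) ^ 2 := by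
  let h : E → ℝ := fun a => ∫ b, g (a, b) ∂β
  have hm : Measurable h := hg.stronglyMeasurable.integral_prod_right'.measurable
  have hh : ∀ a, |h a| ≤ C := fun a => abs_integral_le_of_abs_le fun b => hC _
  have Lh : MemLp h 2 β := memLp_of_abs_le hm hh 2
  have Lg : MemLp g 2 (β.prod β) := memLp_of_abs_le hg hC 2
  have L1 : MemLp (fun p : E × E => h p.1) 2 (β.prod β) :=
    memLp_of_abs_le (hm.comp measurable_fst) (fun p => hh _) 2
  have L2 : MemLp (fun p : E × E => h p.2) 2 (β.prod β) :=
    memLp_of_abs_le (hm.comp measurable_snd) (fun p => hh _) 2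
  have i0 : ∫ p, g p ∂(β.prod β) = ∫ a, h a ∂β := integral_prod _ (Lg.integrable one_le_two)
  have i1 : ∫ p, h p.1 ∂(β.prod β) = ∫ a, h a ∂β := by
    simpa using integral_prod _ (L1.integrable one_le_two)
  have i2 : ∫ p, h p.2 ∂(β.prod β) = ∫ a, h a ∂β := by
    simpa using integral_prod _ (L2.integrable one_le_two)
  have c1 : covariance g (fun p => h p.1) (β.prod β) = variance h β := by
    rw [covariance_eq_sub Lg L1, variance_eq_sub Lh, i0, i1, sq (∫ a, h a ∂β),
      integral_prod _ (by exact Lg.integrable_mul L1)]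
    congr 1
    simp only [Pi.mul_apply, integral_mul_const, Pi.pow_apply, sq, h]
  have c2 : covariance g (fun p => h p.2) (β.prod β) = variance h β := by
    rw [covariance_eq_sub Lg L2, variance_eq_sub Lh, i0, i2, sq (∫ a, h a ∂β),
      integral_prod_symm _ (by exact Lg.integrable_mul L2)]
    congr 1
    refine integral_congr_ae (Filter.Eventually.of_forall fun b => ?_)
    simp only [Pi.mul_apply, integral_mul_const, Pi.pow_apply, sq, h]
    simp_rw [hsymm _ b]
  have c3 : covariance (fun p : E × E => h p.1) (fun p => h p.2) (β.prod β) = 0 :=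
    covariance_fst_snd_prod Lh Lh
  have v1 : variance (fun p : E × E => h p.1) (β.prod β) = variance h β :=
    measurePreserving_fst.variance_fun_comp hm.aemeasurable
  have v2 : variance (fun p : E × E => h p.2) (β.prod β) = variance h β :=
    measurePreserving_snd.variance_fun_comp hm.aemeasurable
  -- This variance equals var g − 2 var h, because h(a) and h(b) are uncorrelated and each has
  -- covariance var h with g.
  have key := variance_nonneg (g - ((fun p : E × E => h p.1) + fun p : E × E => h p.2)) (β.prod β)
  rw [variance_sub Lg (L1.add L2), variance_add L1 L2, covariance_add_right Lg L1 L2, c1, c2, c3,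
    v1, v2, variance_eq_sub Lg, variance_eq_sub Lh, i0] at key
  rw [i0]
  simp only [Pi.pow_apply] at key
  change 2 * ∫ a, h a ^ 2 ∂β ≤ _
  linarith

variable [AddCommMonoid E] [MeasurableAdd₂ E]

/-- The convolution operator of the law `ν`, that is, the average of `φ (y + W)` where `W` has
law `ν`. -/
noncomputable def avgShift (ν : Measure E) (φ : E → ℝ) (y : E) : ℝ := ∫ w, φ (y + w) ∂ν

variable {α β ν : Measure E} [IsProbabilityMeasure α] [IsProbabilityMeasure β]
  [IsProbabilityMeasure ν] {φ : E → ℝ} {C : ℝ}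

lemma measurable_avgShift (hφ : Measurable φ) : Measurable (avgShift ν φ) :=
  (show Measurable fun p : E × E => φ (p.1 + p.2) by
    fun_prop).stronglyMeasurable.integral_prod_right'.measurable

omit [MeasurableAdd₂ E] in
lemma abs_avgShift_le (hC : ∀ x, |φ x| ≤ C) (y : E) : |avgShift ν φ y| ≤ C :=
  abs_integral_le_of_abs_le fun _ => hC _

lemma integral_conv_of_abs_le (hφ : Measurable φ) (hC : ∀ x, |φ x| ≤ C) :
    ∫ x, φ x ∂(α.conv β) = ∫ y, ∫ w, φ (y + w) ∂β ∂α := by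
  have : IsProbabilityMeasure (α.conv β) := inferInstance
  exact integral_conv (integrable_of_abs_le hφ hC)

lemma avgShift_avgShift (hφ : Measurable φ) (hC : ∀ x, |φ x| ≤ C) :
    avgShift α (avgShift β φ) = avgShift (α.conv β) φ := by
  ext y
  simp only [avgShift]
  rw [integral_conv_of_abs_le (φ := fun w => φ (y + w)) (by fun_prop) (fun _ => hC _)]
  simp_rw [add_assoc]

/-- Midpoint convexity of the second moment of a function averaged over a part of the
increments. -/
lemma two_mul_integral_avgShift_sq_le (hφ : Measurable φ) (hC : ∀ x, |φ x| ≤ C) :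
    2 * ∫ x, avgShift β φ x ^ 2 ∂(α.conv β) ≤
      ∫ x, φ x ^ 2 ∂(α.conv (β.conv β)) + ∫ x, avgShift (β.conv β) φ x ^ 2 ∂α := by
  have hφ2 : Measurable fun x => φ x ^ 2 := by fun_prop
  have hC2 : ∀ x, |φ x ^ 2| ≤ C ^ 2 := fun x => abs_sq_le (hC x)
  have hA : ∀ ν : Measure E, IsProbabilityMeasure ν → Measurable fun x => avgShift ν φ x ^ 2 :=
    fun ν _ => (measurable_avgShift hφ).pow_const 2
  have hAC : ∀ ν : Measure E, IsProbabilityMeasure ν → ∀ x, |avgShift ν φ x ^ 2| ≤ C ^ 2 :=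
    fun ν _ x => abs_sq_le (abs_avgShift_le hC x)
  rw [integral_conv_of_abs_le (hA β inferInstance) (hAC β inferInstance),
    integral_conv_of_abs_le hφ2 hC2, ← integral_const_mul, ← integral_add]
  rotate_left
  · exact integrable_of_abs_le (measurable_avgShift hφ2) (abs_avgShift_le hC2)
  · exact integrable_of_abs_le (hA _ inferInstance) (hAC _ inferInstance)
  refine integral_mono ?_ ?_ fun y => ?_
  · exact (integrable_of_abs_le (measurable_avgShift (hA β inferInstance))
      (abs_avgShift_le (hAC β inferInstance))).const_mul 2
  · exact (integrable_of_abs_le (measurable_avgShift hφ2) (abs_avgShift_le hC2)).add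
      (integrable_of_abs_le (hA _ inferInstance) (hAC _ inferInstance))
  -- For fixed y, the kernel φ(y + a + b) in the two i.i.d. increments is symmetric because addition
  -- commutes.
  have hg : Measurable fun p : E × E => φ (y + (p.1 + p.2)) := by fun_prop
  have key := two_mul_integral_sq_le β hg (fun _ => hC _) fun a b => by simp only [add_comm a b]
  have e1 : ∫ p, φ (y + (p.1 + p.2)) ∂(β.prod β) = avgShift (β.conv β) φ y := by
    rw [avgShift, integral_conv_of_abs_le (φ := fun w => φ (y + w)) (by fun_prop) (fun _ => hC _),
      integral_prod _ (integrable_of_abs_le hg fun _ => hC _)]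
  have e2 : ∫ p, φ (y + (p.1 + p.2)) ^ 2 ∂(β.prod β) = ∫ w, φ (y + w) ^ 2 ∂(β.conv β) := by
    rw [integral_conv_of_abs_le (φ := fun w => φ (y + w) ^ 2) (by fun_prop) (fun _ => hC2 _),
      integral_prod _ (integrable_of_abs_le (by fun_prop) fun _ => hC2 _)]
  simp only [e1, e2] at key
  simpa only [avgShift, add_assoc] using key

/-- A bounded function on `[0,1]` satisfying the two midpoint inequalities anchored at the
end points lies below its chord. -/
lemma le_chord_of_midpoint {V : ℝ → ℝ} {K : ℝ} (h0 : 0 ≤ V 0) (h1 : 0 ≤ V 1)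
    (hK : ∀ r, V r ≤ K) (hmid : ∀ a δ, 0 ≤ a → 0 ≤ δ → a + 2 * δ ≤ 1 →
      2 * V (a + δ) ≤ V (a + 2 * δ) + V a) {r : ℝ} (hr0 : 0 ≤ r) (hr1 : r ≤ 1) :
    V r ≤ r * V 1 + (1 - r) * V 0 := by
  -- The error above the chord halves at each stage: r is the midpoint of 0 and 2r, or of 2r − 1 and
  -- 1, and the other end is handled by induction. No continuity of V is needed.
  have hn : ∀ (n : ℕ) (r : ℝ), 0 ≤ r → r ≤ 1 → V r ≤ r * V 1 + (1 - r) * V 0 + K * (1 / 2) ^ n := by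
    intro n
    induction n with
    | zero =>
      intro r hr0 hr1
      have := hK r
      have := mul_nonneg hr0 h1
      have := mul_nonneg (sub_nonneg.2 hr1) h0
      simp only [pow_zero, mul_one]
      linarith
    | succ n ih =>
      intro r hr0 hr1
      rw [pow_succ]
      rcases le_total r (1 / 2) with h | h
      · have e1 := hmid 0 r le_rfl hr0 (by linarith)
        have e2 := ih (2 * r) (by linarith) (by linarith)
        rw [zero_add, zero_add] at e1
        linarith
      · have e1 := hmid (2 * r - 1) (1 - r) (by linarith) (by linarith) (by linarith)
        have e2 := ih (2 * r - 1) (by linarith) (by linarith)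
        rw [show 2 * r - 1 + (1 - r) = r by ring, show 2 * r - 1 + 2 * (1 - r) = 1 by ring] at e1
        linarith
  have hlim : Filter.Tendsto (fun n : ℕ => r * V 1 + (1 - r) * V 0 + K * (1 / 2 : ℝ) ^ n)
      Filter.atTop (nhds (r * V 1 + (1 - r) * V 0 + K * 0)) :=
    ((tendsto_pow_atTop_nhds_zero_of_lt_one (by norm_num) (by norm_num)).const_mul K).const_add _
  rw [mul_zero, add_zero] at hlim
  exact ge_of_tendsto' hlim fun n => hn n r hr0 hr1

variable {μ : ℝ → Measure E} [∀ r, IsProbabilityMeasure (μ r)]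

/-- The left side is V(r) = E[E{φ(S_1)|S_r}²]; since S_0 = 0, the chord joins the squared mean V(0)
to the second moment V(1). -/
lemma integral_avgShift_sq_le (hμ : ∀ r s, 0 ≤ r → 0 ≤ s → (μ r).conv (μ s) = μ (r + s))
    (hμ0 : μ 0 = Measure.dirac 0) (hφ : Measurable φ) (hC : ∀ x, |φ x| ≤ C) {r : ℝ}
    (hr0 : 0 ≤ r) (hr1 : r ≤ 1) :
    ∫ x, avgShift (μ (1 - r)) φ x ^ 2 ∂(μ r) ≤
      r * ∫ x, φ x ^ 2 ∂(μ 1) + (1 - r) * (∫ x, φ x ∂(μ 1)) ^ 2 := by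
  have := le_chord_of_midpoint (V := fun r => ∫ x, avgShift (μ (1 - r)) φ x ^ 2 ∂(μ r))
    (K := C ^ 2) (integral_nonneg fun _ => sq_nonneg _) (integral_nonneg fun _ => sq_nonneg _)
    (fun r => (le_abs_self _).trans
      (abs_integral_le_of_abs_le fun x => abs_sq_le (abs_avgShift_le hC x))) ?_ hr0 hr1
  · have e : avgShift (Measure.dirac 0) φ = φ := by
      ext y
      rw [avgShift, integral_dirac' _ _ (by fun_prop), add_zero]
    have e' : avgShift (μ 1) φ 0 = ∫ x, φ x ∂(μ 1) := by simp only [avgShift, zero_add]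
    simp only [sub_self, hμ0, e, sub_zero] at this
    rwa [integral_dirac' _ _ ((measurable_avgShift hφ).pow_const 2).stronglyMeasurable, e'] at this
  · intro a δ ha hδ had
    -- The function used is φ already averaged over the remaining time 1 − (a + 2δ).
    have key := two_mul_integral_avgShift_sq_le (α := μ a) (β := μ δ)
      (measurable_avgShift (ν := μ (1 - (a + 2 * δ))) hφ) (abs_avgShift_le hC)
    rw [avgShift_avgShift hφ hC, avgShift_avgShift hφ hC, hμ δ δ hδ hδ,
      hμ a δ ha hδ, hμ a (δ + δ) ha (by linarith), hμ δ _ hδ (by linarith),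
      hμ (δ + δ) _ (by linarith) (by linarith)] at key
    convert key using 5 <;> ring_nf

/-- In a convolution semigroup, the dependence between the sum at time `1` and the
sum at time `s` is at most `s`. -/
lemma depMeasure_conv_semigroup_le
    (hμ : ∀ r s, 0 ≤ r → 0 ≤ s → (μ r).conv (μ s) = μ (r + s))
    (hμ0 : μ 0 = Measure.dirac 0) {s : ℝ} (hs0 : 0 ≤ s) (hs1 : s ≤ 1) :
    depMeasure ((μ s).prod (μ (1 - s))) (fun p => p.1 + p.2) Prod.fst ≤ s := by
  refine depMeasure_le_of_bounded hs0 (by fun_prop) measurable_fst fun φ ψ C hφ hψ hφC hψC => ?_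
  have hF : Measurable (avgShift (μ (1 - s)) φ) := measurable_avgShift hφ
  have hconv : (μ s).conv (μ (1 - s)) = μ 1 := by
    rw [hμ _ _ hs0 (by linarith), add_sub_cancel]
  have m1 : Measurable fun p : E × E => φ (p.1 + p.2) := by fun_prop
  have m2 : Measurable fun p : E × E => ψ p.1 := by fun_prop
  have L1 : MemLp (fun p : E × E => φ (p.1 + p.2)) 2 ((μ s).prod (μ (1 - s))) :=
    memLp_of_abs_le m1 (fun _ => hφC _) 2
  have L2 : MemLp (fun p : E × E => ψ p.1) 2 ((μ s).prod (μ (1 - s))) :=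
    memLp_of_abs_le m2 (fun _ => hψC _) 2
  have LF : MemLp (avgShift (μ (1 - s)) φ) 2 (μ s) := memLp_of_abs_le hF (abs_avgShift_le hφC) 2
  have Lψ : MemLp ψ 2 (μ s) := memLp_of_abs_le hψ hψC 2
  have Lφ : MemLp φ 2 (μ 1) := memLp_of_abs_le hφ hφC 2
  have i1 : ∫ p, φ (p.1 + p.2) ∂((μ s).prod (μ (1 - s))) = ∫ y, avgShift (μ (1 - s)) φ y ∂(μ s) :=
    integral_prod _ (L1.integrable one_le_two)
  have i2 : ∫ p, ψ p.1 ∂((μ s).prod (μ (1 - s))) = ∫ y, ψ y ∂(μ s) := by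
    simpa using integral_prod _ (L2.integrable one_le_two)
  have i3 : ∫ y, avgShift (μ (1 - s)) φ y ∂(μ s) = ∫ x, φ x ∂(μ 1) := by
    rw [← hconv, integral_conv_of_abs_le hφ hφC]
    rfl
  have hcov : covariance (fun p : E × E => φ (p.1 + p.2)) (fun p => ψ p.1)
      ((μ s).prod (μ (1 - s))) = covariance (avgShift (μ (1 - s)) φ) ψ (μ s) := by
    rw [covariance_eq_sub L1 L2, covariance_eq_sub LF Lψ, i1, i2,
      integral_prod _ (by exact L1.integrable_mul L2)]
    congr 1
    simp only [Pi.mul_apply, integral_mul_const, avgShift]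
  have hv1 : variance (fun p : E × E => φ (p.1 + p.2)) ((μ s).prod (μ (1 - s))) =
      variance φ (μ 1) := by
    rw [← hconv, Measure.conv, variance_map hφ.aemeasurable (by fun_prop)]
    rfl
  have hv2 : variance (fun p : E × E => ψ p.1) ((μ s).prod (μ (1 - s))) = variance ψ (μ s) :=
    measurePreserving_fst.variance_fun_comp hψ.aemeasurable
  have hvF : variance (avgShift (μ (1 - s)) φ) (μ s) ≤ s * variance φ (μ 1) := by
    have := integral_avgShift_sq_le hμ hμ0 hφ hφC hs0 hs1
    rw [variance_eq_sub LF, variance_eq_sub Lφ, i3]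
    simp only [Pi.pow_apply]
    linarith
  rw [hcov, hv1, hv2, ← mul_assoc]
  exact (covariance_sq_le LF Lψ).trans (mul_le_mul_of_nonneg_right hvF (variance_nonneg _ _))

/-- The form used for Gaussian pairs: a function of S_s and independent noise, against S_1. Data
processing, symmetry and removal of the independent noise reduce it to D(S_1 : S_s). -/
lemma depMeasure_conv_semigroup_prod_le
    (hμ : ∀ r s, 0 ≤ r → 0 ≤ s → (μ r).conv (μ s) = μ (r + s))
    (hμ0 : μ 0 = Measure.dirac 0) {s : ℝ} (hs0 : 0 ≤ s) (hs1 : s ≤ 1) {F G : Type*}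
    [MeasurableSpace F] [MeasurableSpace G] (κ : Measure F) [IsProbabilityMeasure κ]
    {f : E × F → G} (hf : Measurable f) :
    depMeasure (((μ s).prod (μ (1 - s))).prod κ) (fun p => f (p.1.1, p.2))
      (fun p => p.1.1 + p.1.2) ≤ s := by
  set Q := ((μ s).prod (μ (1 - s))).prod κ with hQ
  have h3 : depMeasure Q (fun p => f (p.1.1, p.2)) (fun p => p.1.1 + p.1.2) ≤
      depMeasure Q (fun p => (p.1.1, p.2)) (fun p => p.1.1 + p.1.2) :=
    depMeasure_comp_le (X := fun p : (E × E) × F => (p.1.1, p.2)) (g := id) (by fun_prop) hf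
      measurable_id
  have h4 : depMeasure Q (fun p => (p.1.1, p.2)) (fun p => p.1.1 + p.1.2) =
      depMeasure Q (fun p => p.1.1 + p.1.2) (fun p => p.1.1) := by
    rw [depMeasure_comm (by fun_prop) (by fun_prop)]
    refine depMeasure_prodMk_of_indepFun (by fun_prop) (by fun_prop) measurable_snd ?_
    exact indepFun_prod (X := fun q : E × E => (q.1 + q.2, q.1))
      (Y := fun z : F => z) (by fun_prop) (by fun_prop)
  have h5 : depMeasure Q (fun p => p.1.1 + p.1.2) (fun p => p.1.1) =
      depMeasure ((μ s).prod (μ (1 - s))) (fun p => p.1 + p.2) Prod.fst := by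
    refine depMeasure_eq_of_map_eq (by fun_prop) (by fun_prop) (by fun_prop) (by fun_prop) ?_
    have e : (μ s).prod (μ (1 - s)) = Q.map Prod.fst := by simp [Q]
    rw [e, Measure.map_map (by fun_prop) (by fun_prop)]
    rfl
  exact (h3.trans_eq (h4.trans h5)).trans (depMeasure_conv_semigroup_le hμ hμ0 hs0 hs1)

end ConvolutionSemigroup

/-! ### Gaussian vectors as a semigroup value plus independent noise. -/

section Gaussian

open Matrix

variable {Ω : Type*} [mΩ : MeasurableSpace Ω] {P : Measure Ω} [IsProbabilityMeasure P] {m n : ℕ}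
  {X : Ω → Fin m → ℝ} {Y : Ω → Fin n → ℝ}

lemma measurable_dotProduct_comp (hX : Measurable X) (a : Fin m → ℝ) :
    Measurable fun ω => a ⬝ᵥ X ω := by
  simp only [dotProduct]; fun_prop

omit [IsProbabilityMeasure P] in
lemma memLp_dotProduct (hX2 : ∀ i, MemLp (fun ω => X ω i) 2 P) (a : Fin m → ℝ) :
    MemLp (fun ω => a ⬝ᵥ X ω) 2 P := by
  simp only [dotProduct]
  exact memLp_finsetSum _ fun i _ => (hX2 i).const_mul (a i)

lemma covariance_dotProduct (hX2 : ∀ i, MemLp (fun ω => X ω i) 2 P)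
    (hY2 : ∀ j, MemLp (fun ω => Y ω j) 2 P) (a : Fin m → ℝ) (b : Fin n → ℝ) :
    covariance (fun ω => a ⬝ᵥ X ω) (fun ω => b ⬝ᵥ Y ω) P = a ⬝ᵥ covMat P X Y *ᵥ b := by
  simp only [dotProduct, mulVec]
  rw [covariance_fun_sum_fun_sum (fun i => (hX2 i).const_mul (a i))
    (fun j => (hY2 j).const_mul (b j))]
  simp only [covariance_const_mul_left, covariance_const_mul_right, covMat, Matrix.of_apply,
    Finset.mul_sum]
  exact Finset.sum_congr rfl fun i _ => Finset.sum_congr rfl fun j _ => by ring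

lemma variance_dotProduct (hX : Measurable X) (hX2 : ∀ i, MemLp (fun ω => X ω i) 2 P)
    (a : Fin m → ℝ) : variance (fun ω => a ⬝ᵥ X ω) P = a ⬝ᵥ covMat P X X *ᵥ a := by
  rw [← covariance_dotProduct hX2 hX2, covariance_self (measurable_dotProduct_comp hX a).aemeasurable]

omit [IsProbabilityMeasure P] in
lemma covMat_transpose : (covMat P X Y)ᵀ = covMat P Y X := by
  ext i j
  exact covariance_comm _ _

lemma posSemidef_covMat (hX : Measurable X) (hX2 : ∀ i, MemLp (fun ω => X ω i) 2 P) :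
    (covMat P X X).PosSemidef := by
  refine PosSemidef.of_dotProduct_mulVec_nonneg ?_ fun a => ?_
  · rw [IsHermitian, conjTranspose_eq_transpose_of_trivial, covMat_transpose]
  · rw [star_trivial, ← variance_dotProduct hX hX2]
    exact variance_nonneg _ _

/-- The centered Gaussian law on `ℝⁿ` with covariance matrix `V`. -/
noncomputable def centeredGaussian (V : Matrix (Fin n) (Fin n) ℝ) : Measure (Fin n → ℝ) :=
  (multivariateGaussian 0 V).map WithLp.ofLp

lemma measurable_euclidean_ofLp :
    Measurable (WithLp.ofLp : EuclideanSpace ℝ (Fin n) → Fin n → ℝ) := by fun_prop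

instance isProbabilityMeasure_centeredGaussian (V : Matrix (Fin n) (Fin n) ℝ) :
    IsProbabilityMeasure (centeredGaussian V) :=
  Measure.isProbabilityMeasure_map measurable_euclidean_ofLp.aemeasurable

lemma integral_exp_centeredGaussian {V : Matrix (Fin n) (Fin n) ℝ} (hV : V.PosSemidef)
    (a : Fin n → ℝ) :
    ∫ x, Complex.exp ((a ⬝ᵥ x : ℝ) * Complex.I) ∂(centeredGaussian V) =
      Complex.exp (-((a ⬝ᵥ V *ᵥ a : ℝ) : ℂ) / 2) := by
  have h := charFun_multivariateGaussian (μ := 0) hV (WithLp.toLp 2 a)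
  have hmeas : Measurable fun x : Fin n → ℝ => Complex.exp ((a ⬝ᵥ x : ℝ) * Complex.I) := by
    simp only [dotProduct]; fun_prop
  rw [charFun_apply] at h
  rw [centeredGaussian, integral_map measurable_euclidean_ofLp.aemeasurable
    hmeas.aestronglyMeasurable]
  convert h using 2
  · ext x
    simp [PiLp.inner_apply, dotProduct]
  · simp [neg_div]

lemma exists_dotProduct_eq_dual (L : StrongDual ℝ (Fin n → ℝ)) :
    ∃ a : Fin n → ℝ, ∀ x, L x = a ⬝ᵥ x := by
  refine ⟨fun i => L (Pi.single i 1), fun x => ?_⟩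
  conv_lhs => rw [pi_eq_sum_univ' x]
  simp [dotProduct, mul_comm]

/-- The exponent of the characteristic function is linear in the covariance matrix; hence r ↦ N(0,
rV) is a convolution semigroup. -/
lemma centeredGaussian_conv {V W : Matrix (Fin n) (Fin n) ℝ} (hV : V.PosSemidef)
    (hW : W.PosSemidef) :
    (centeredGaussian V).conv (centeredGaussian W) = centeredGaussian (V + W) := by
  refine Measure.ext_of_charFunDual (funext fun L => ?_)
  obtain ⟨a, ha⟩ := exists_dotProduct_eq_dual L
  rw [charFunDual_conv]
  simp only [charFunDual_apply, ha]
  rw [integral_exp_centeredGaussian hV, integral_exp_centeredGaussian hW,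
    integral_exp_centeredGaussian (hV.add hW), ← Complex.exp_add, add_mulVec, dotProduct_add]
  congr 1
  push_cast
  ring

lemma centeredGaussian_zero :
    centeredGaussian (0 : Matrix (Fin n) (Fin n) ℝ) = Measure.dirac 0 := by
  refine Measure.ext_of_charFunDual (funext fun L => ?_)
  obtain ⟨a, ha⟩ := exists_dotProduct_eq_dual L
  rw [charFunDual_dirac]
  simp only [charFunDual_apply, ha]
  rw [integral_exp_centeredGaussian PosSemidef.zero]
  simp

/-- A jointly Gaussian pair is, up to its mean, of the form `(A y + v, y + w)` with independent
Gaussian vectors `y`, `w`, `v`, if the covariances match. -/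
lemma map_sub_mean_eq (hX : Measurable X) (hY : Measurable Y)
    (hG : HasGaussianLaw (fun ω => (X ω, Y ω)) P) {V W : Matrix (Fin n) (Fin n) ℝ}
    {K : Matrix (Fin m) (Fin m) ℝ} {A : Matrix (Fin m) (Fin n) ℝ} (hV : V.PosSemidef)
    (hW : W.PosSemidef) (hK : K.PosSemidef) (hYY : covMat P Y Y = V + W)
    (hXY : covMat P X Y = A * V) (hXX : covMat P X X = A * V * Aᵀ + K) :
    P.map (fun ω => (X ω - ∫ ω, X ω ∂P, Y ω - ∫ ω, Y ω ∂P)) =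
      (((centeredGaussian V).prod (centeredGaussian W)).prod (centeredGaussian K)).map
        (fun p => (A *ᵥ p.1.1 + p.2, p.1.1 + p.1.2)) := by
  have hGX : HasGaussianLaw X P := hG.fst
  have hGY : HasGaussianLaw Y P := hG.snd
  have hX2 : ∀ i, MemLp (fun ω => X ω i) 2 P := fun i => (hGX.eval i).memLp_two
  have hY2 : ∀ i, MemLp (fun ω => Y ω i) 2 P := fun i => (hGY.eval i).memLp_two
  have hA : Measurable fun y : Fin n → ℝ => A *ᵥ y :=
    (Continuous.matrix_mulVec continuous_const continuous_id).measurable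
  have hΦ : Measurable fun p : ((Fin n → ℝ) × (Fin n → ℝ)) × (Fin m → ℝ) =>
      (A *ᵥ p.1.1 + p.2, p.1.1 + p.1.2) := by fun_prop
  have := Measure.isProbabilityMeasure_map (μ := P)
    (f := fun ω => (X ω - ∫ ω, X ω ∂P, Y ω - ∫ ω, Y ω ∂P)) (by fun_prop)
  have := Measure.isProbabilityMeasure_map
    (μ := ((centeredGaussian V).prod (centeredGaussian W)).prod (centeredGaussian K))
    hΦ.aemeasurable
  refine Measure.ext_of_charFunDual (funext fun L => ?_)
  obtain ⟨a, ha⟩ := exists_dotProduct_eq_dual (L.comp (.inl ℝ _ _))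
  obtain ⟨b, hb⟩ := exists_dotProduct_eq_dual (L.comp (.inr ℝ _ _))
  have hL : ∀ x y, L (x, y) = a ⬝ᵥ x + b ⬝ᵥ y := by
    intro x y
    rw [← ha, ← hb, ContinuousLinearMap.comp_apply, ContinuousLinearMap.comp_apply, ← map_add]
    simp
  have hLm : Measurable fun z => Complex.exp (L z * Complex.I) := by fun_prop
  have hvar : variance (fun ω => L (X ω, Y ω)) P =
      a ⬝ᵥ covMat P X X *ᵥ a + 2 * (a ⬝ᵥ covMat P X Y *ᵥ b) + b ⬝ᵥ covMat P Y Y *ᵥ b := by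
    simp only [hL]
    rw [variance_fun_add (memLp_dotProduct hX2 a) (memLp_dotProduct hY2 b),
      variance_dotProduct hX hX2, variance_dotProduct hY hY2, covariance_dotProduct hX2 hY2]
  have hmean : ∫ ω, L (X ω, Y ω) ∂P = L (∫ ω, X ω ∂P, ∫ ω, Y ω ∂P) := by
    rw [L.integral_comp_comm hG.integrable, integral_pair hGX.integrable hGY.integrable]
  have h1 : charFunDual (P.map (fun ω => (X ω - ∫ ω, X ω ∂P, Y ω - ∫ ω, Y ω ∂P))) L =
      Complex.exp (-((a ⬝ᵥ covMat P X X *ᵥ a + 2 * (a ⬝ᵥ covMat P X Y *ᵥ b) +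
        b ⬝ᵥ covMat P Y Y *ᵥ b : ℝ) : ℂ) / 2) := by
    have e := hG.charFunDual_map_eq_fun L
    have e' := charFunDual_map_add_const (μ := P.map fun ω => (X ω, Y ω))
      (-(∫ ω, X ω ∂P, ∫ ω, Y ω ∂P)) L
    rw [Measure.map_map (by fun_prop) (hX.prodMk hY), e] at e'
    rw [← hvar]
    convert e' using 1
    · congr 2
    · rw [← Complex.exp_add]
      congr 1
      rw [hmean, map_neg]
      push_cast
      ring
  rw [h1, charFunDual_apply, integral_map hΦ.aemeasurable hLm.aestronglyMeasurable]
  -- Moving A to the dual side splits the character into one factor for each independent coordinate.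
  have h2 : ∀ p : ((Fin n → ℝ) × (Fin n → ℝ)) × (Fin m → ℝ),
      Complex.exp (L (A *ᵥ p.1.1 + p.2, p.1.1 + p.1.2) * Complex.I) =
      (Complex.exp (((Aᵀ *ᵥ a + b) ⬝ᵥ p.1.1 : ℝ) * Complex.I) *
        Complex.exp ((b ⬝ᵥ p.1.2 : ℝ) * Complex.I)) * Complex.exp ((a ⬝ᵥ p.2 : ℝ) * Complex.I) := by
    intro p
    rw [← Complex.exp_add, ← Complex.exp_add, hL, dotProduct_add, dotProduct_add, add_dotProduct,
      dotProduct_mulVec, mulVec_transpose]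
    congr 1
    push_cast
    ring
  simp only [h2]
  rw [integral_prod_mul (fun q : (Fin n → ℝ) × (Fin n → ℝ) =>
      Complex.exp (((Aᵀ *ᵥ a + b) ⬝ᵥ q.1 : ℝ) * Complex.I) *
        Complex.exp ((b ⬝ᵥ q.2 : ℝ) * Complex.I))
      (fun v => Complex.exp ((a ⬝ᵥ v : ℝ) * Complex.I)),
    integral_prod_mul (fun y => Complex.exp (((Aᵀ *ᵥ a + b) ⬝ᵥ y : ℝ) * Complex.I))
      (fun w => Complex.exp ((b ⬝ᵥ w : ℝ) * Complex.I)),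
    integral_exp_centeredGaussian hV, integral_exp_centeredGaussian hW,
    integral_exp_centeredGaussian hK, ← Complex.exp_add, ← Complex.exp_add, hYY, hXY, hXX]
  congr 1
  have hVt : Vᵀ = V := by
    have := hV.isHermitian
    rwa [IsHermitian, conjTranspose_eq_transpose_of_trivial] at this
  have e1 : a ⬝ᵥ (A * V * Aᵀ) *ᵥ a = (Aᵀ *ᵥ a) ⬝ᵥ V *ᵥ (Aᵀ *ᵥ a) := by
    rw [← mulVec_mulVec, ← mulVec_mulVec, dotProduct_mulVec, mulVec_transpose]
  have e2 : a ⬝ᵥ (A * V) *ᵥ b = (Aᵀ *ᵥ a) ⬝ᵥ V *ᵥ b := by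
    rw [← mulVec_mulVec, dotProduct_mulVec, mulVec_transpose]
  have e3 : b ⬝ᵥ V *ᵥ (Aᵀ *ᵥ a) = (Aᵀ *ᵥ a) ⬝ᵥ V *ᵥ b := by
    rw [dotProduct_mulVec, ← mulVec_transpose, hVt, dotProduct_comm]
  simp only [add_mulVec, mulVec_add, dotProduct_add, add_dotProduct, e1, e2, e3]
  push_cast
  ring

/-- The upper bound for the dependence between the components of a Gaussian vector, where `B` is
the regression matrix of `X` on `Y`. -/
lemma depMeasure_le_of_hasGaussianLaw (hX : Measurable X) (hY : Measurable Y)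
    (hG : HasGaussianLaw (fun ω => (X ω, Y ω)) P) {B : Matrix (Fin m) (Fin n) ℝ}
    (hB : B * covMat P Y Y = covMat P X Y) {s : ℝ} (hs0 : 0 < s) (hs1 : s ≤ 1)
    (hK : (covMat P X X - s⁻¹ • (B * covMat P Y Y * Bᵀ)).PosSemidef) :
    depMeasure P X Y ≤ s := by
  have hY2 : ∀ i, MemLp (fun ω => Y ω i) 2 P := fun i =>
    ((HasGaussianLaw.snd hG).eval i).memLp_two
  have hV := posSemidef_covMat hY hY2
  set V := covMat P Y Y with hVdef
  let μ : ℝ → Measure (Fin n → ℝ) := fun r => centeredGaussian (r • V)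
  have hμ : ∀ r s, 0 ≤ r → 0 ≤ s → (μ r).conv (μ s) = μ (r + s) := fun r s hr hs => by
    simp only [μ]
    rw [centeredGaussian_conv (hV.smul hr) (hV.smul hs), add_smul]
  have hμ0 : μ 0 = Measure.dirac 0 := by simp only [μ, zero_smul, centeredGaussian_zero]
  -- The time-s variable has covariance sV, so its coefficient must be s⁻¹B to reproduce cov(X, Y) =
  -- BV; what remains of var X is the matrix in `hK`.
  have hsB : (s⁻¹ • B) * (s • V) = B * V := by
    rw [Matrix.smul_mul, Matrix.mul_smul, smul_smul, inv_mul_cancel₀ hs0.ne', one_smul]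
  have hA : Measurable fun y : Fin n → ℝ => (s⁻¹ • B) *ᵥ y :=
    (Continuous.matrix_mulVec continuous_const continuous_id).measurable
  have hlaw := map_sub_mean_eq hX hY hG (A := s⁻¹ • B) (V := s • V) (W := (1 - s) • V)
    (hV.smul hs0.le) (hV.smul (sub_nonneg.2 hs1)) hK (by rw [← add_smul]; simp [hVdef])
    (by rw [hsB, hB]) (by rw [hsB, transpose_smul, Matrix.mul_smul]; abel)
  have h1 : depMeasure P X Y ≤ depMeasure P (fun ω => X ω - ∫ ω, X ω ∂P)
      (fun ω => Y ω - ∫ ω, Y ω ∂P) := by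
    have := depMeasure_comp_le (P := P) (X := fun ω => X ω - ∫ ω, X ω ∂P)
      (Y := fun ω => Y ω - ∫ ω, Y ω ∂P) (f := fun x => x + ∫ ω, X ω ∂P)
      (g := fun y => y + ∫ ω, Y ω ∂P) (by fun_prop) (by fun_prop) (by fun_prop)
    simpa using this
  have hf : Measurable fun q : (Fin n → ℝ) × (Fin m → ℝ) => (s⁻¹ • B) *ᵥ q.1 + q.2 :=
    (hA.comp measurable_fst).add measurable_snd
  have h2 := depMeasure_eq_of_map_eq (hX.sub_const _) (hY.sub_const _)
    (hf.comp (measurable_fst.fst.prodMk measurable_snd))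
    (measurable_fst.fst.add measurable_fst.snd) hlaw
  exact (h1.trans_eq h2).trans
    (depMeasure_conv_semigroup_prod_le hμ hμ0 hs0.le hs1 (centeredGaussian _) hf)

end Gaussian

/-! ### The canonical matrix, its maximal eigenvalue and the Gaussian formulas. -/

section Canonical

open Matrix

/-- A real symmetric matrix has a maximal eigenvalue, and is bounded by it. -/
lemma exists_isMaxEigenvalue {m : ℕ} (hm : 0 < m) {A : Matrix (Fin m) (Fin m) ℝ}
    (hA : A.IsHermitian) :
    ∃ l : ℝ, IsMaxEigenvalue A l ∧ (l • (1 : Matrix (Fin m) (Fin m) ℝ) - A).PosSemidef := by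
  have hne : (Finset.univ : Finset (Fin m)).Nonempty := ⟨⟨0, hm⟩, Finset.mem_univ _⟩
  obtain ⟨i, -, hi⟩ := Finset.exists_max_image Finset.univ hA.eigenvalues hne
  have hmem : ∀ t : ℝ, t ∈ spectrum ℝ A ↔ t ∈ Set.range hA.eigenvalues := fun t => by
    rw [hA.spectrum_real_eq_range_eigenvalues]
  have hset : ∀ t : ℝ, Module.End.HasEigenvalue (Matrix.toLin' A) t ↔ t ∈ spectrum ℝ A := fun t => by
    rw [Module.End.hasEigenvalue_iff_mem_spectrum, Matrix.spectrum_toLin']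
  refine ⟨hA.eigenvalues i, ⟨(hset _).2 ((hmem _).2 ⟨i, rfl⟩), ?_⟩, ?_⟩
  · intro t ht
    obtain ⟨j, rfl⟩ := (hmem t).1 ((hset t).1 ht)
    exact hi j (Finset.mem_univ _)
  · have hB : (hA.eigenvalues i • (1 : Matrix (Fin m) (Fin m) ℝ) - A).IsHermitian :=
      (isHermitian_one.smul (IsSelfAdjoint.all _)).sub hA
    rw [hB.posSemidef_iff_eigenvalues_nonneg]
    intro j
    have hj : hB.eigenvalues j ∈
        spectrum ℝ (hA.eigenvalues i • (1 : Matrix (Fin m) (Fin m) ℝ) - A) := by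
      rw [hB.spectrum_real_eq_range_eigenvalues]; exact ⟨j, rfl⟩
    have hspec : spectrum ℝ (hA.eigenvalues i • (1 : Matrix (Fin m) (Fin m) ℝ) - A) =
        (fun t => hA.eigenvalues i - t) '' spectrum ℝ A := by
      rw [← Algebra.algebraMap_eq_smul_one, ← spectrum.singleton_sub_eq, Set.singleton_sub]
    obtain ⟨t, ht, htj⟩ := hspec ▸ hj
    obtain ⟨k, rfl⟩ := (hmem t).1 ht
    have := hi k (Finset.mem_univ _)
    simp only at htj
    rw [← htj, Pi.zero_apply]
    linarith

/-- Approaching l from above lets the semigroup bound, which divides by s, cover l = 0; values s ≥ 1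
are settled by d ≤ 1. -/
lemma le_of_forall_pos_le_one {d l : ℝ} (hl : 0 ≤ l) (hd : d ≤ 1)
    (h : ∀ s, 0 < s → s ≤ 1 → l ≤ s → d ≤ s) : d ≤ l := by
  refine le_of_forall_gt_imp_ge_of_dense fun s hs => ?_
  rcases le_total s 1 with h1 | h1
  · exact h s (hl.trans_lt hs) h1 hs.le
  · exact hd.trans h1

variable {Ω : Type*} [mΩ : MeasurableSpace Ω] {P : Measure Ω} [IsProbabilityMeasure P] {m n : ℕ}
  {X : Ω → Fin m → ℝ} {Y : Ω → Fin n → ℝ}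

lemma sqrt_inv_covMat (hX : Measurable X) (hX2 : ∀ i, MemLp (fun ω => X ω i) 2 P) :
    (CFC.sqrt (covMat P X X)⁻¹)ᵀ = CFC.sqrt (covMat P X X)⁻¹ ∧
      CFC.sqrt (covMat P X X)⁻¹ * CFC.sqrt (covMat P X X)⁻¹ = (covMat P X X)⁻¹ := by
  have h0 : 0 ≤ (covMat P X X)⁻¹ := (posSemidef_covMat hX hX2).inv.nonneg
  refine ⟨?_, CFC.sqrt_mul_sqrt_self _ h0⟩
  have h1 : (CFC.sqrt (covMat P X X)⁻¹).PosSemidef := (CFC.sqrt_nonneg _).posSemidef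
  have h2 := h1.isHermitian
  rwa [IsHermitian, conjTranspose_eq_transpose_of_trivial] at h2

lemma isHermitian_canonMat (hX : Measurable X) (hY : Measurable Y)
    (hX2 : ∀ i, MemLp (fun ω => X ω i) 2 P) (hY2 : ∀ j, MemLp (fun ω => Y ω j) 2 P) :
    (canonMat P X Y).IsHermitian := by
  have h2 := (posSemidef_covMat hY hY2).inv.isHermitian
  rw [IsHermitian, conjTranspose_eq_transpose_of_trivial] at h2 ⊢
  simp only [canonMat, transpose_mul, covMat_transpose, (sqrt_inv_covMat hX hX2).1, h2,
    Matrix.mul_assoc]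

/-- Every eigenvalue of the canonical matrix is nonnegative and bounded by the measure of
dependence. -/
lemma eigenvalue_canonMat_le (hX : Measurable X) (hY : Measurable Y)
    (hX2 : ∀ i, MemLp (fun ω => X ω i) 2 P) (hY2 : ∀ j, MemLp (fun ω => Y ω j) 2 P)
    (hXX : IsUnit (covMat P X X)) (hYY : IsUnit (covMat P Y Y)) {l : ℝ}
    (hl : Module.End.HasEigenvalue (Matrix.toLin' (canonMat P X Y)) l) :
    0 ≤ l ∧ l ≤ depMeasure P X Y := by
  obtain ⟨u, hu⟩ := hl.exists_hasEigenvector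
  have hu1 : canonMat P X Y *ᵥ u = l • u := by
    have := hu.apply_eq_smul
    rwa [Matrix.toLin'_apply] at this
  have hN : 0 < u ⬝ᵥ u := by
    have := dotProduct_star_self_pos_iff.2 hu.2
    simpa using this
  obtain ⟨hRt, hRR⟩ := sqrt_inv_covMat (P := P) hX hX2
  have hXXd := (isUnit_iff_isUnit_det _).1 hXX
  have hYYd := (isUnit_iff_isUnit_det _).1 hYY
  rw [canonMat] at hu1
  set R := CFC.sqrt (covMat P X X)⁻¹ with hR
  set V := covMat P X X with hV
  set W := covMat P Y Y with hW
  set C := covMat P X Y with hC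
  have hRVR : R * V * R = 1 := by
    rw [mul_eq_one_comm, ← Matrix.mul_assoc, hRR, nonsing_inv_mul _ hXXd]
  -- The witnesses are a·X and its linear regression b·Y on Y: var(a·X) = |u|², while var(b·Y) and
  -- cov(a·X, b·Y) both equal l|u|².
  set a := R *ᵥ u with ha
  set b := W⁻¹ *ᵥ (covMat P Y X *ᵥ a) with hb
  have hcov : a ⬝ᵥ C *ᵥ b = l * (u ⬝ᵥ u) := by
    have : R *ᵥ (C *ᵥ b) = l • u := by
      rw [← hu1, hb, ha]
      simp only [mulVec_mulVec, Matrix.mul_assoc]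
    rw [ha, ← hRt, mulVec_transpose, ← dotProduct_mulVec, this, dotProduct_smul, smul_eq_mul]
  have hva : a ⬝ᵥ V *ᵥ a = u ⬝ᵥ u := by
    have : R *ᵥ (V *ᵥ a) = u := by
      rw [ha, mulVec_mulVec, mulVec_mulVec, hRVR, one_mulVec]
    calc a ⬝ᵥ V *ᵥ a = (Rᵀ *ᵥ u) ⬝ᵥ V *ᵥ a := by rw [hRt]
      _ = u ⬝ᵥ u := by rw [mulVec_transpose, ← dotProduct_mulVec, this]
  have hvb : b ⬝ᵥ W *ᵥ b = l * (u ⬝ᵥ u) := by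
    have : W *ᵥ b = covMat P Y X *ᵥ a := by
      rw [hb, mulVec_mulVec, mul_nonsing_inv _ hYYd, one_mulVec]
    rw [this, ← hcov, ← covMat_transpose (X := X) (Y := Y), mulVec_transpose, dotProduct_comm,
      ← dotProduct_mulVec]
  have h0 : 0 ≤ l * (u ⬝ᵥ u) := by
    rw [← hvb, hW, ← variance_dotProduct hY hY2]; exact variance_nonneg _ _
  have hl0 : 0 ≤ l := nonneg_of_mul_nonneg_left h0 hN
  refine ⟨hl0, ?_⟩
  have ma : Measurable fun x : Fin m → ℝ => a ⬝ᵥ x := by simp only [dotProduct]; fun_prop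
  have mb : Measurable fun x : Fin n → ℝ => b ⬝ᵥ x := by simp only [dotProduct]; fun_prop
  have key := covariance_sq_le_depMeasure (P := P) (X := X) hY ma mb (memLp_dotProduct hX2 a)
    (memLp_dotProduct hY2 b)
  rw [covariance_dotProduct hX2 hY2, variance_dotProduct hX hX2, variance_dotProduct hY hY2,
    hcov, hva, hvb] at key
  -- Now `key` reads l²|u|⁴ ≤ D · l|u|⁴; cancelling needs l > 0.
  rcases hl0.eq_or_lt with h | h
  · rw [← h]; exact depMeasure_nonneg _ _ _
  · have hpos : 0 < l * (u ⬝ᵥ u) * (u ⬝ᵥ u) := by positivity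
    refine le_of_mul_le_mul_right ?_ hpos
    linarith

lemma depMeasure_le_of_canonMat_le (hX : Measurable X) (hY : Measurable Y)
    (hG : HasGaussianLaw (fun ω => (X ω, Y ω)) P)
    (hXX : IsUnit (covMat P X X)) (hYY : IsUnit (covMat P Y Y)) {l : ℝ} (hl0 : 0 ≤ l)
    (hl : (l • (1 : Matrix (Fin m) (Fin m) ℝ) - canonMat P X Y).PosSemidef) :
    depMeasure P X Y ≤ l := by
  have hX2 : ∀ i, MemLp (fun ω => X ω i) 2 P := fun i =>
    ((HasGaussianLaw.fst hG).eval i).memLp_two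
  have hY2 : ∀ i, MemLp (fun ω => Y ω i) 2 P := fun i =>
    ((HasGaussianLaw.snd hG).eval i).memLp_two
  refine le_of_forall_pos_le_one hl0 (depMeasure_le_one hY) fun s hs0 hs1 hls => ?_
  have hXXd := (isUnit_iff_isUnit_det _).1 hXX
  have hYYd := (isUnit_iff_isUnit_det _).1 hYY
  have hBW : covMat P X Y * (covMat P Y Y)⁻¹ * covMat P Y Y = covMat P X Y := by
    rw [Matrix.mul_assoc, nonsing_inv_mul _ hYYd, Matrix.mul_one]
  refine depMeasure_le_of_hasGaussianLaw hX hY hG hBW hs0 hs1 ?_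
  obtain ⟨hRt, hRR⟩ := sqrt_inv_covMat (P := P) hX hX2
  have hVt : (covMat P X X)ᵀ = covMat P X X := covMat_transpose
  have hWt : ((covMat P Y Y)⁻¹)ᵀ = (covMat P Y Y)⁻¹ := by
    rw [transpose_nonsing_inv, covMat_transpose]
  have hs : (s • (1 : Matrix (Fin m) (Fin m) ℝ) - canonMat P X Y).PosSemidef := by
    have := hl.add (PosSemidef.one.smul (sub_nonneg.2 hls))
    convert this using 1
    rw [sub_smul]; abel
  -- Congruence by V₁₁V₁₁^{-1/2} turns s·1 − Σ into sV₁₁ − V₁₂V₂₂⁻¹V₂₁, which is s times the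
  -- required noise covariance.
  have hT := (hs.mul_mul_conjTranspose_same
    (covMat P X X * CFC.sqrt (covMat P X X)⁻¹)).smul (inv_nonneg.2 hs0.le)
  convert hT using 1
  have hTt : (covMat P X X * CFC.sqrt (covMat P X X)⁻¹)ᵀ =
      CFC.sqrt (covMat P X X)⁻¹ * covMat P X X := by rw [transpose_mul, hRt, hVt]
  rw [conjTranspose_eq_transpose_of_trivial, hTt, hBW, transpose_mul, hWt, covMat_transpose,
    canonMat]
  set R := CFC.sqrt (covMat P X X)⁻¹ with hR
  set V := covMat P X X with hV
  set W := covMat P Y Y with hW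
  set C := covMat P X Y with hC
  have e1 : V * R * (R * V) = V := by
    rw [Matrix.mul_assoc, ← Matrix.mul_assoc R, hRR, nonsing_inv_mul _ hXXd, Matrix.mul_one]
  have e2 : V * R * R = 1 := by rw [Matrix.mul_assoc, hRR, mul_nonsing_inv _ hXXd]
  have e3 : R * (R * V) = 1 := by rw [← Matrix.mul_assoc, hRR, nonsing_inv_mul _ hXXd]
  have e4 : V * R * (R * C * W⁻¹ * covMat P Y X * R) * (R * V) = C * (W⁻¹ * covMat P Y X) := by
    calc _ = (V * R * R) * (C * (W⁻¹ * covMat P Y X)) * (R * (R * V)) := by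
          simp only [Matrix.mul_assoc]
      _ = _ := by rw [e2, e3, Matrix.one_mul, Matrix.mul_one]
  rw [Matrix.mul_sub, Matrix.sub_mul, e4, Matrix.mul_smul, Matrix.mul_one, Matrix.smul_mul, e1,
    smul_sub, smul_smul, inv_mul_cancel₀ hs0.ne', one_smul]

/-- The one-dimensional case of the regression bound: with B = cov(X, Y)/var Y, positivity of the
noise variance amounts to ρ² ≤ s. -/
lemma depMeasure_le_pearsonCorr_sq {X Y : Ω → ℝ} (hX : Measurable X) (hY : Measurable Y)
    (hG : HasGaussianLaw (fun ω => (X ω, Y ω)) P) (hvX : 0 < variance X P)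
    (hvY : 0 < variance Y P) : depMeasure P X Y ≤ pearsonCorr P X Y ^ 2 := by
  refine le_of_forall_pos_le_one (sq_nonneg _) (depMeasure_le_one hY) fun s hs0 hs1 hρ => ?_
  have h1 : depMeasure P X Y ≤ depMeasure P (fun ω (_ : Fin 1) => X ω) (fun ω (_ : Fin 1) => Y ω) :=
    depMeasure_comp_le (X := fun ω (_ : Fin 1) => X ω) (Y := fun ω (_ : Fin 1) => Y ω)
      (f := fun x : Fin 1 → ℝ => x 0) (g := fun x : Fin 1 → ℝ => x 0)
      (by fun_prop) (by fun_prop) (by fun_prop)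
  refine h1.trans ?_
  have hG1 : HasGaussianLaw (fun ω => ((fun _ : Fin 1 => X ω), (fun _ : Fin 1 => Y ω))) P :=
    hG.map_fun ((ContinuousLinearMap.pi fun _ : Fin 1 => ContinuousLinearMap.fst ℝ ℝ ℝ).prod
      (ContinuousLinearMap.pi fun _ : Fin 1 => ContinuousLinearMap.snd ℝ ℝ ℝ))
  have hcX : covMat P (fun ω (_ : Fin 1) => X ω) (fun ω (_ : Fin 1) => X ω) =
      Matrix.diagonal fun _ => variance X P := by
    ext i j
    simp [covMat, Subsingleton.elim j i, covariance_self hX.aemeasurable]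
  have hcY : covMat P (fun ω (_ : Fin 1) => Y ω) (fun ω (_ : Fin 1) => Y ω) =
      Matrix.diagonal fun _ => variance Y P := by
    ext i j
    simp [covMat, Subsingleton.elim j i, covariance_self hY.aemeasurable]
  have hcXY : covMat P (fun ω (_ : Fin 1) => X ω) (fun ω (_ : Fin 1) => Y ω) =
      Matrix.diagonal fun _ => covariance X Y P := by
    ext i j
    simp [covMat, Subsingleton.elim j i]
  refine depMeasure_le_of_hasGaussianLaw (by fun_prop) (by fun_prop) hG1
    (B := Matrix.diagonal fun _ => covariance X Y P / variance Y P) ?_ hs0 hs1 ?_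
  · rw [hcY, hcXY, diagonal_mul_diagonal]
    simp [hvY.ne']
  · rw [hcX, hcY, diagonal_transpose, diagonal_mul_diagonal, diagonal_mul_diagonal,
      ← diagonal_smul, diagonal_sub, posSemidef_diagonal_iff]
    intro i
    have key := pearsonCorr_sq_mul hvX hvY
    have h2 : covariance X Y P ^ 2 ≤ s * (variance X P * variance Y P) := by
      rw [← key]; exact mul_le_mul_of_nonneg_right hρ (by positivity)
    simp only [Pi.smul_apply, smul_eq_mul]
    rw [sub_nonneg, show s⁻¹ * (covariance X Y P / variance Y P * variance Y P *
      (covariance X Y P / variance Y P)) = covariance X Y P ^ 2 / (s * variance Y P) by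
        field_simp, div_le_iff₀ (by positivity)]
    linarith

end Canonical

/-! ### Assembly of the twelve statements. -/

theorem theorem1 {Ω S T : Type*} [MeasurableSpace Ω] [MeasurableSpace S] [MeasurableSpace T]
    (P : Measure Ω) [IsProbabilityMeasure P]
    (X : Ω → S) (hX : Measurable X) (Y : Ω → T) (hY : Measurable Y) :
    -- (i)
    (0 ≤ depMeasure P X Y ∧ depMeasure P X Y ≤ 1) ∧
    -- (ii)
    (depMeasure P X Y = 0 ↔ IndepFun X Y P) ∧
    -- (iii), for nondegenerate X, with an example showing that the converse fails
    (((∃ A : Set S, MeasurableSet A ∧ P (X ⁻¹' A) ≠ 0 ∧ P (X ⁻¹' A) ≠ 1) →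
        (∃ h : T → S, Measurable h ∧ X =ᵐ[P] fun ω => h (Y ω)) → depMeasure P X Y = 1) ∧
      (∃ Q : Measure (ℝ × ℝ), IsProbabilityMeasure Q ∧
        depMeasure Q (Prod.fst : ℝ × ℝ → ℝ) (Prod.snd : ℝ × ℝ → ℝ) = 1 ∧
        ¬ ∃ h : ℝ → ℝ, Measurable h ∧
          (Prod.fst : ℝ × ℝ → ℝ) =ᵐ[Q] fun p => h p.2)) ∧
    -- (iv)
    (∀ {U : Type*} [MeasurableSpace U] (Z : Ω → U), Measurable Z →
      depMeasure P X Y ≤ depMeasure P X (fun ω => (Y ω, Z ω))) ∧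
    -- (v)
    (∀ {U : Type*} [MeasurableSpace U] (Z : Ω → U), Measurable Z →
      IndepFun (fun ω => (X ω, Y ω)) Z P →
      depMeasure P X (fun ω => (Y ω, Z ω)) = depMeasure P X Y) ∧
    -- (vi)
    (∀ X₁ Y₁ : Ω → ℝ, Measurable X₁ → Measurable Y₁ →
      HasGaussianLaw (fun ω => (X₁ ω, Y₁ ω)) P →
      0 < variance X₁ P → 0 < variance Y₁ P →
      depMeasure P X₁ Y₁ = pearsonCorr P X₁ Y₁ ^ 2) ∧
    -- (vii)
    (∀ X₁ Y₁ : Ω → ℝ, Measurable X₁ → Measurable Y₁ → MemLp X₁ 2 P → MemLp Y₁ 2 P →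
      0 < variance X₁ P → 0 < variance Y₁ P →
      pearsonCorr P X₁ Y₁ ^ 2 ≤ depMeasure P X₁ Y₁) ∧
    -- (viii)
    (∀ (m n : ℕ) (X₁ : Ω → Fin m → ℝ) (Y₁ : Ω → Fin n → ℝ), 0 < m →
      Measurable X₁ → Measurable Y₁ →
      HasGaussianLaw (fun ω => (X₁ ω, Y₁ ω)) P →
      IsUnit (covMat P X₁ X₁) → IsUnit (covMat P Y₁ Y₁) →
      ∃ l : ℝ, IsMaxEigenvalue (canonMat P X₁ Y₁) l ∧ depMeasure P X₁ Y₁ = l) ∧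
    -- (ix)
    (∀ (m n : ℕ) (X₁ : Ω → Fin m → ℝ) (Y₁ : Ω → Fin n → ℝ), 0 < m →
      Measurable X₁ → Measurable Y₁ →
      (∀ i, MemLp (fun ω => X₁ ω i) 2 P) → (∀ j, MemLp (fun ω => Y₁ ω j) 2 P) →
      IsUnit (covMat P X₁ X₁) → IsUnit (covMat P Y₁ Y₁) →
      ∃ l : ℝ, IsMaxEigenvalue (canonMat P X₁ Y₁) l ∧ l ≤ depMeasure P X₁ Y₁) ∧
    -- (x)
    (∀ Y₁ Z : Ω → ℝ, Measurable Y₁ → Measurable Z →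
      IsSelfDecomposable (P.map Z) → IndepFun (fun ω => (X ω, Y₁ ω)) Z P →
      MonotoneOn (fun t : ℝ => depMeasure P X (fun ω => Y₁ ω + t * Z ω)) (Iio 0) ∧
      AntitoneOn (fun t : ℝ => depMeasure P X (fun ω => Y₁ ω + t * Z ω)) (Ioi 0)) ∧
    -- (xi)
    depMeasure P X Y = maxCorr P X Y ^ 2 ∧
    -- (xii)
    depMeasure P X Y = depMeasure P Y X := by
  refine ⟨⟨depMeasure_nonneg P X Y, depMeasure_le_one hY⟩, depMeasure_eq_zero_iff hX hY,
    ⟨?_, exists_depMeasure_eq_one_not_function⟩, ?_, ?_, ?_, ?_, ?_, ?_, ?_,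
    depMeasure_eq_maxCorr_sq hY, depMeasure_comm hX hY⟩
  · rintro ⟨A, hA, h0, h1⟩ ⟨h, hh, hXh⟩
    refine depMeasure_eq_one hX hY hA (hh hA) ?_ h0 h1
    filter_upwards [hXh] with ω hω
    rw [hω, Set.mem_preimage]
  · intro U _ Z hZ
    exact depMeasure_comp_le (f := id) (g := Prod.fst) (hY.prodMk hZ) measurable_id measurable_fst
  · intro U _ Z hZ hind
    exact depMeasure_prodMk_of_indepFun hX hY hZ hind
  · intro X₁ Y₁ hX₁ hY₁ hG hvX hvY
    have hX2 : MemLp X₁ 2 P := (HasGaussianLaw.fst hG).memLp_two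
    have hY2 : MemLp Y₁ 2 P := (HasGaussianLaw.snd hG).memLp_two
    exact (depMeasure_le_pearsonCorr_sq hX₁ hY₁ hG hvX hvY).antisymm
      (pearsonCorr_sq_le_depMeasure (φ := id) (ψ := id) hY₁ measurable_id measurable_id hX2 hY2
        hvX hvY)
  · intro X₁ Y₁ hX₁ hY₁ hX2 hY2 hvX hvY
    exact pearsonCorr_sq_le_depMeasure (φ := id) (ψ := id) hY₁ measurable_id measurable_id hX2 hY2
      hvX hvY
  · intro m n X₁ Y₁ hm hX₁ hY₁ hG hXX hYY
    have hX2 : ∀ i, MemLp (fun ω => X₁ ω i) 2 P := fun i =>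
      ((HasGaussianLaw.fst hG).eval i).memLp_two
    have hY2 : ∀ i, MemLp (fun ω => Y₁ ω i) 2 P := fun i =>
      ((HasGaussianLaw.snd hG).eval i).memLp_two
    obtain ⟨l, hl, hpsd⟩ := exists_isMaxEigenvalue hm (isHermitian_canonMat hX₁ hY₁ hX2 hY2)
    obtain ⟨hl0, hle⟩ := eigenvalue_canonMat_le hX₁ hY₁ hX2 hY2 hXX hYY hl.1
    exact ⟨l, hl, (depMeasure_le_of_canonMat_le hX₁ hY₁ hG hXX hYY hl0 hpsd).antisymm hle⟩
  · intro m n X₁ Y₁ hm hX₁ hY₁ hX2 hY2 hXX hYY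
    obtain ⟨l, hl, -⟩ := exists_isMaxEigenvalue hm (isHermitian_canonMat hX₁ hY₁ hX2 hY2)
    exact ⟨l, hl, (eigenvalue_canonMat_le hX₁ hY₁ hX2 hY2 hXX hYY hl.1).2⟩
  · intro Y₁ Z hY₁ hZ hsd hind
    -- Self-decomposability with c = s/t handles both half-lines: s and t have the same sign and |s|
    -- < |t|.
    have key : ∀ s t : ℝ, t ≠ 0 → 0 < s / t → s / t < 1 →
        depMeasure P X (fun ω => Y₁ ω + t * Z ω) ≤ depMeasure P X (fun ω => Y₁ ω + s * Z ω) := by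
      intro s t ht h0 h1
      have := depMeasure_add_mul_le_of_isSelfDecomposable hX hY₁ hZ hsd hind h0 h1 t
      rwa [div_mul_cancel₀ _ ht] at this
    refine ⟨fun s hs t ht hst => ?_, fun s hs t ht hst => ?_⟩
    · rcases hst.eq_or_lt with rfl | hlt
      · exact le_rfl
      · exact key t s (ne_of_lt hs) (div_pos_of_neg_of_neg ht hs) ((div_lt_one_of_neg hs).2 hlt)
    · rcases hst.eq_or_lt with rfl | hlt
      · exact le_rfl
      · exact key s t (ne_of_gt ht) (div_pos hs ht) ((div_lt_one ht).2 hlt)
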